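/- For $n\ge 1$, an $n$-configuration is a map $c\colon \mathcal P(\{1,\dots,n\})\setminus\{\emptyset\}\to\{0,1\}$; it is realisable in a group $G$ if there are subgroups $H_1,\dots,H_n\le G$ such that, for every non-empty $I\subseteq\{1,\dots,n\}$, the intersection $\bigcap_{i\in I}H_i$ is finitely generated if and only if $c(I)=0$. A group $G$ is intersection-saturated if for every $n\ge 1$ every $n$-configuration is realisable in $G$. Let Thompson's group $F$ be the group, under composition, of all orientation-preserving homeomorphisms of $[0,1]$ that are piecewise linear with finitely many breakpoints, all of them dyadic rationals, and all of whose slopes are integral powers of $2$. **Corollary B.** Thompson's group $F$ is finitely presented, intersection-saturated, and contains no non-abelian free subgroup. In particular, there exist finitely presented intersection-saturated groups without non-abelian free subgroups. -/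

import Mathlib

/-- An `n`-configuration: a map from the non-empty subsets of an `n`-element set to `{0, 1}`. -/
def Configuration (n : ℕ) : Type := {I : Finset (Fin n) // I.Nonempty} → Fin 2

/-- An `n`-configuration `c` is realisable in `G` if there are subgroups `H₁, …, Hₙ` of `G` such
that, for every non-empty set `I` of indices, `⋂ i ∈ I, Hᵢ` is finitely generated if and only if
`c I = 0`. -/
def Configuration.Realisable {n : ℕ} (c : Configuration n) (G : Type*) [Group G] : Prop :=
  ∃ H : Fin n → Subgroup G,
    ∀ I : {I : Finset (Fin n) // I.Nonempty}, (⨅ i ∈ I.1, H i).FG ↔ c I = 0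

/-- A group is intersection-saturated if all `n`-configurations, `n ≥ 1`, are realisable in it. -/
def IntersectionSaturated (G : Type*) [Group G] : Prop :=
  ∀ n : ℕ, 1 ≤ n → ∀ c : Configuration n, c.Realisable G

/-- A group has no non-abelian free subgroup: every subgroup that is free is abelian. -/
def NoNonabelianFreeSubgroup (G : Type*) [Group G] : Prop :=
  ∀ H : Subgroup G, IsFreeGroup H → ∀ a ∈ H, ∀ b ∈ H, a * b = b * a

/-- A real number is a dyadic rational if it is of the form `a / 2 ^ m` with `a : ℤ`, `m : ℕ`. -/
def IsDyadic (x : ℝ) : Prop := ∃ (a : ℤ) (m : ℕ), x = a / 2 ^ m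

theorem IsDyadic.add {x y : ℝ} (hx : IsDyadic x) (hy : IsDyadic y) : IsDyadic (x + y) := by
  obtain ⟨a, m, rfl⟩ := hx
  obtain ⟨b, n, rfl⟩ := hy
  refine ⟨a * 2 ^ n + b * 2 ^ m, m + n, ?_⟩
  push_cast
  field_simp
  ring

theorem IsDyadic.neg {x : ℝ} (hx : IsDyadic x) : IsDyadic (-x) := by
  obtain ⟨a, m, rfl⟩ := hx
  exact ⟨-a, m, by push_cast; ring⟩

theorem IsDyadic.sub {x y : ℝ} (hx : IsDyadic x) (hy : IsDyadic y) : IsDyadic (x - y) := by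
  simpa [sub_eq_add_neg] using hx.add hy.neg

theorem IsDyadic.zpow_mul {x : ℝ} (hx : IsDyadic x) (k : ℤ) : IsDyadic ((2 : ℝ) ^ k * x) := by
  obtain ⟨a, m, rfl⟩ := hx
  obtain ⟨n, rfl | rfl⟩ := k.eq_nat_or_neg
  · exact ⟨2 ^ n * a, m, by push_cast; rw [zpow_natCast]; ring⟩
  · refine ⟨a, m + n, ?_⟩
    rw [zpow_neg, zpow_natCast]
    field_simp
    ring

/-- The increasing bijections of `[0, 1]`; these are exactly its orientation-preserving
homeomorphisms. They form a group under composition. -/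
abbrev IncHomeo : Type := Set.Icc (0 : ℝ) 1 ≃o Set.Icc (0 : ℝ) 1

/-- `f` is affine, with slope an integral power of `2`, on every closed subinterval of `[0, 1]`
that has no point of `B` in its interior. -/
def IncHomeo.IsPLWith (f : IncHomeo) (B : Finset (Set.Icc (0 : ℝ) 1)) : Prop :=
  ∀ a b : Set.Icc (0 : ℝ) 1, a < b → (∀ x ∈ B, ¬ (a < x ∧ x < b)) →
    ∃ k : ℤ, ∀ x : Set.Icc (0 : ℝ) 1, a ≤ x → x ≤ b →
      (f x : ℝ) = (f a : ℝ) + (2 : ℝ) ^ k * ((x : ℝ) - (a : ℝ))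

/-- `f` is piecewise linear with finitely many breakpoints, all of them dyadic rationals, and all
its slopes are integral powers of `2`. -/
def IncHomeo.IsDyadicPL (f : IncHomeo) : Prop :=
  ∃ B : Finset (Set.Icc (0 : ℝ) 1), (∀ x ∈ B, IsDyadic (x : ℝ)) ∧ f.IsPLWith B

theorem IncHomeo.IsDyadicPL.isDyadic_apply {f : IncHomeo} (hf : f.IsDyadicPL)
    (x : Set.Icc (0 : ℝ) 1) (hx : IsDyadic (x : ℝ)) : IsDyadic (f x : ℝ) := by
  obtain ⟨B, hB, h⟩ := hf
  have key : ∀ (N : ℕ) (x : Set.Icc (0 : ℝ) 1), IsDyadic (x : ℝ) →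
      (B.filter (fun y => y < x)).card ≤ N → IsDyadic (f x : ℝ) := by
    intro N
    induction N with
    | zero =>
      intro x hx hc
      rcases eq_or_lt_of_le (bot_le : (⊥ : Set.Icc (0 : ℝ) 1) ≤ x) with h0 | h0
      · rw [← h0, f.map_bot]; exact ⟨0, 0, by simp⟩
      · obtain ⟨k, hk⟩ := h ⊥ x h0 (by
          rintro y hy ⟨-, hyx⟩
          have : y ∈ B.filter (fun y => y < x) := Finset.mem_filter.2 ⟨hy, hyx⟩
          have := Finset.card_pos.2 ⟨y, this⟩
          omega)
        rw [hk x h0.le le_rfl, f.map_bot]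
        simpa using hx.zpow_mul k
    | succ N ih =>
      intro x hx hc
      by_cases hne : (B.filter (fun y => y < x)).Nonempty
      · set b := (B.filter (fun y => y < x)).max' hne with hb
        have hbm := (B.filter (fun y => y < x)).max'_mem hne
        rw [← hb, Finset.mem_filter] at hbm
        have hfb : IsDyadic (f b : ℝ) := by
          refine ih b (hB b hbm.1) ?_
          have hlt : (B.filter (fun y => y < b)).card < (B.filter (fun y => y < x)).card := by
            refine Finset.card_lt_card ((Finset.ssubset_iff_of_subset ?_).2 ⟨b, ?_, ?_⟩)
            · intro y hy
              rw [Finset.mem_filter] at hy ⊢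
              exact ⟨hy.1, hy.2.trans hbm.2⟩
            · exact Finset.mem_filter.2 hbm
            · simp
          omega
        obtain ⟨k, hk⟩ := h b x hbm.2 (by
          rintro y hy ⟨hby, hyx⟩
          exact absurd ((B.filter (fun y => y < x)).le_max' y (Finset.mem_filter.2 ⟨hy, hyx⟩))
            (not_le.2 hby))
        rw [hk x hbm.2.le le_rfl]
        exact hfb.add ((hx.sub (hB b hbm.1)).zpow_mul k)
      · rw [Finset.not_nonempty_iff_eq_empty] at hne
        exact ih x hx (by simp [hne])
  exact key _ x hx le_rfl

theorem IncHomeo.IsDyadicPL.inv {f : IncHomeo} (hf : f.IsDyadicPL) : (f⁻¹).IsDyadicPL := by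
  have hd := fun x => hf.isDyadic_apply x
  obtain ⟨B, hB, h⟩ := hf
  classical
  refine ⟨B.image f, ?_, ?_⟩
  · intro y hy
    obtain ⟨x, hx, rfl⟩ := Finset.mem_image.1 hy
    exact hd x (hB x hx)
  · intro a b hab hfree
    change ∃ k : ℤ, ∀ x : Set.Icc (0 : ℝ) 1, a ≤ x → x ≤ b →
      (f.symm x : ℝ) = (f.symm a : ℝ) + (2 : ℝ) ^ k * ((x : ℝ) - (a : ℝ))
    obtain ⟨k, hk⟩ := h (f.symm a) (f.symm b) (f.symm.lt_iff_lt.2 hab) (by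
      rintro x hx ⟨h1, h2⟩
      exact hfree (f x) (Finset.mem_image_of_mem f hx)
        ⟨f.symm_apply_lt.1 h1, f.lt_symm_apply.1 h2⟩)
    refine ⟨-k, fun x hax hxb => ?_⟩
    have := hk (f.symm x) (f.symm.le_iff_le.2 hax) (f.symm.le_iff_le.2 hxb)
    rw [f.apply_symm_apply, f.apply_symm_apply] at this
    have h2 : (2 : ℝ) ^ k ≠ 0 := by positivity
    rw [this, zpow_neg]
    field_simp
    ring

theorem IncHomeo.IsDyadicPL.mul {f g : IncHomeo} (hf : f.IsDyadicPL) (hg : g.IsDyadicPL) :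
    (f * g).IsDyadicPL := by
  have hd := fun x => hg.inv.isDyadic_apply x
  obtain ⟨B, hB, h⟩ := hf
  obtain ⟨C, hC, h'⟩ := hg
  classical
  refine ⟨C ∪ B.image g.symm, ?_, ?_⟩
  · intro y hy
    rcases Finset.mem_union.1 hy with hy | hy
    · exact hC y hy
    · obtain ⟨x, hx, rfl⟩ := Finset.mem_image.1 hy
      exact hd x (hB x hx)
  · intro a b hab hfree
    change ∃ k : ℤ, ∀ x : Set.Icc (0 : ℝ) 1, a ≤ x → x ≤ b →
      (f (g x) : ℝ) = (f (g a) : ℝ) + (2 : ℝ) ^ k * ((x : ℝ) - (a : ℝ))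
    obtain ⟨k, hk⟩ := h' a b hab (fun x hx => hfree x (Finset.mem_union_left _ hx))
    obtain ⟨l, hl⟩ := h (g a) (g b) (g.lt_iff_lt.2 hab) (by
      rintro x hx ⟨h1, h2⟩
      exact hfree (g.symm x) (Finset.mem_union_right _ (Finset.mem_image_of_mem _ hx))
        ⟨g.lt_symm_apply.2 h1, g.symm_apply_lt.2 h2⟩)
    refine ⟨l + k, fun x hax hxb => ?_⟩
    rw [hl (g x) (g.le_iff_le.2 hax) (g.le_iff_le.2 hxb), hk x hax hxb,
      zpow_add₀ (two_ne_zero)]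
    ring

/-- Thompson's group `F`: the group, under composition, of the orientation-preserving
homeomorphisms of `[0, 1]` that are piecewise linear with finitely many breakpoints, all of them
dyadic rationals, and whose slopes are all integral powers of `2`. -/
def ThompsonF : Subgroup IncHomeo where
  carrier := {f | f.IsDyadicPL}
  one_mem' := ⟨∅, by simp, fun a b _ _ => ⟨0, fun x _ _ => by simp⟩⟩
  mul_mem' := fun hf hg => hf.mul hg
  inv_mem' := fun hf => hf.inv

/-! Finite presentation. The elements $x_n$ = `gen n` satisfy $x_nx_k=x_kx_{n+1}$ for $k<n$. They
generate $F$: a positive word $q$ subdivides $[0,1)$ so finely that $fq$ sends each cell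
$[1-2^{-j},1-2^{-j-1}]$ affinely to a standard dyadic interval. Such a map is a positive word,
obtained by repeatedly merging sibling images, and the slope at $1$ counts the merges
(`closure_range_gen`). In any group generated by a sequence with these relations, each element is
$pq^{-1}$ with $p,q$ sorted positive words. In $F$, the slopes at $0$ of successive tails recover
the exponents of a sorted word, so the relations are complete (`injective_of_relations`). Two of
them imply the others, since the later generators are conjugates of $x_1$ by powers of $x_0$
(`conjSeq_relations`).

No free subgroups (Brin and Squier). Let $K=\langle a,b\rangle$ be non-abelian. An element of
$[K,K]$ is the identity near every point fixed by $K$, because its one-sided slopes there are $1$.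
Choose $w\ne1$ in $[K,K]$ moving the fewest components of the complement of the fixed set. A
conjugate $v$ of $w$ has support disjoint from that of $w$ inside one such component, so $[w,v]$
moves fewer and must be trivial (`exists_conj_smaller`). In a free group $w$ and $v$ would be powers
of one element, but each moves a point that the other fixes.

Saturation. In $F\times\mathbb Z^n$, take the pairs $(g,v)$ with $v$ supported in $T$ and $\sum v_j$
equal to the log-slope of $g$ at $0$. They form a finitely generated group exactly when
$T\ne\emptyset$. These groups realise every configuration with a single value $1$
(`exists_indicator`); a finite product combines them, and it embeds in $F$ because $F\times F$ does.
-/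

open Filter Topology commutatorElement

-- The two halves of the interval, gluing maps along them, and the first generator

local notation "𝕀" => Set.Icc (0 : ℝ) 1

/-- The affine bijection from `[0, 1]` to its lower half. -/
noncomputable def lo (x : 𝕀) : 𝕀 :=
  ⟨x / 2, by have := x.2.1; have := x.2.2; constructor <;> linarith⟩

/-- The affine bijection from `[0, 1]` to its upper half. -/
noncomputable def hi (x : 𝕀) : 𝕀 :=
  ⟨(1 + x) / 2, by have := x.2.1; have := x.2.2; constructor <;> linarith⟩

@[simp] theorem coe_lo (x : 𝕀) : (lo x : ℝ) = x / 2 := rfl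

@[simp] theorem coe_hi (x : 𝕀) : (hi x : ℝ) = (1 + x) / 2 := rfl

theorem lo_or_hi (y : 𝕀) : (∃ x, y = lo x) ∨ ∃ x, y = hi x := by
  have h0 := y.2.1
  have h1 := y.2.2
  rcases le_total (y : ℝ) (1 / 2) with h | h
  · exact Or.inl ⟨⟨2 * y, by constructor <;> linarith⟩, Subtype.ext (by simp)⟩
  · exact Or.inr ⟨⟨2 * y - 1, by constructor <;> linarith⟩, Subtype.ext (by simp)⟩

@[simp] theorem lo_le_lo {x y : 𝕀} : lo x ≤ lo y ↔ x ≤ y := by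
  rw [← Subtype.coe_le_coe, ← Subtype.coe_le_coe, coe_lo, coe_lo]
  constructor <;> intro h <;> linarith

@[simp] theorem hi_le_hi {x y : 𝕀} : hi x ≤ hi y ↔ x ≤ y := by
  rw [← Subtype.coe_le_coe, ← Subtype.coe_le_coe, coe_hi, coe_hi]
  constructor <;> intro h <;> linarith

theorem lo_le_hi (x y : 𝕀) : lo x ≤ hi y := by
  rw [← Subtype.coe_le_coe, coe_lo, coe_hi]
  linarith [x.2.2, y.2.1]

theorem eq_top_bot_of_hi_le_lo {x y : 𝕀} (h : hi x ≤ lo y) : x = ⊥ ∧ y = ⊤ := by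
  rw [← Subtype.coe_le_coe, coe_lo, coe_hi] at h
  have hx := x.2.1
  have hy := y.2.2
  exact ⟨Subtype.ext (show (x : ℝ) = 0 by linarith), Subtype.ext (show (y : ℝ) = 1 by linarith)⟩

theorem lo_top : lo ⊤ = hi ⊥ := Subtype.ext (show (1 : ℝ) / 2 = (1 + 0) / 2 by norm_num)

theorem lo_bot : lo ⊥ = ⊥ := Subtype.ext (show (0 : ℝ) / 2 = 0 by norm_num)

theorem hi_top : hi ⊤ = ⊤ := Subtype.ext (show (1 + 1 : ℝ) / 2 = 1 by norm_num)

theorem lo_injective : Function.Injective lo := fun _ _ h =>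
  le_antisymm (lo_le_lo.1 h.le) (lo_le_lo.1 h.ge)

theorem hi_injective : Function.Injective hi := fun _ _ h =>
  le_antisymm (hi_le_hi.1 h.le) (hi_le_hi.1 h.ge)

theorem lo_strictMono : StrictMono lo := fun _ _ h =>
  lt_of_not_ge fun h' => h.not_ge (lo_le_lo.1 h')

theorem hi_strictMono : StrictMono hi := fun _ _ h =>
  lt_of_not_ge fun h' => h.not_ge (hi_le_hi.1 h')

theorem IncHomeo.ext' {f g : IncHomeo} (h : ∀ x, f x = g x) : f = g := RelIso.ext h

theorem IncHomeo.inv_apply_self (f : IncHomeo) (x : 𝕀) : f⁻¹ (f x) = x := f.symm_apply_apply x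

theorem IncHomeo.apply_inv_self (f : IncHomeo) (x : 𝕀) : f (f⁻¹ x) = x := f.apply_symm_apply x

open Classical in
/-- The map acting as `f` on the lower half and as `g` on the upper half. -/
noncomputable def pairFun (f g : 𝕀 → 𝕀) (y : 𝕀) : 𝕀 :=
  if h : ∃ x, y = lo x then lo (f h.choose) else
    if h' : ∃ x, y = hi x then hi (g h'.choose) else y

theorem pairFun_lo (f g : 𝕀 → 𝕀) (x : 𝕀) : pairFun f g (lo x) = lo (f x) := by
  have h : ∃ z, lo x = lo z := ⟨x, rfl⟩
  rw [pairFun, dif_pos h, ← lo_injective h.choose_spec]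

/-- At the midpoint `lo ⊤ = hi ⊥` the lower branch of the definition takes precedence. The branches
agree there because increasing bijections fix both endpoints. -/
theorem pairFun_hi (f g : IncHomeo) (x : 𝕀) : pairFun f g (hi x) = hi (g x) := by
  by_cases h : ∃ z, hi x = lo z
  · obtain ⟨z, hz⟩ := h
    obtain ⟨rfl, rfl⟩ := eq_top_bot_of_hi_le_lo hz.le
    rw [hz, pairFun_lo, f.map_top, g.map_bot, lo_top]
  · have h' : ∃ z, hi x = hi z := ⟨x, rfl⟩
    rw [pairFun, dif_neg h, dif_pos h', ← hi_injective h'.choose_spec]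

theorem pairFun_monotone (f g : IncHomeo) : Monotone (pairFun f g) := by
  intro a b hab
  obtain ⟨a, rfl⟩ | ⟨a, rfl⟩ := lo_or_hi a <;> obtain ⟨b, rfl⟩ | ⟨b, rfl⟩ := lo_or_hi b
  · simpa [pairFun_lo] using hab
  · rw [pairFun_lo, pairFun_hi]
    exact lo_le_hi _ _
  · obtain ⟨rfl, rfl⟩ := eq_top_bot_of_hi_le_lo hab
    rw [← lo_top]
  · simpa [pairFun_hi] using hab

theorem pairFun_symm (f g : IncHomeo) (x : 𝕀) : pairFun f.symm g.symm (pairFun f g x) = x := by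
  obtain ⟨x, rfl⟩ | ⟨x, rfl⟩ := lo_or_hi x
  · rw [pairFun_lo, pairFun_lo, f.symm_apply_apply]
  · rw [pairFun_hi, pairFun_hi, g.symm_apply_apply]

/-- The increasing bijection acting as `f` on the lower half and as `g` on the upper half. -/
noncomputable def IncHomeo.pair (f g : IncHomeo) : IncHomeo :=
  Equiv.toOrderIso
    { toFun := pairFun f g
      invFun := pairFun f.symm g.symm
      left_inv := pairFun_symm f g
      right_inv := pairFun_symm f.symm g.symm }
    (pairFun_monotone f g) (pairFun_monotone f.symm g.symm)

@[simp] theorem IncHomeo.pair_lo (f g : IncHomeo) (x : 𝕀) : pair f g (lo x) = lo (f x) :=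
  pairFun_lo f g x

@[simp] theorem IncHomeo.pair_hi (f g : IncHomeo) (x : 𝕀) : pair f g (hi x) = hi (g x) :=
  pairFun_hi f g x

theorem IncHomeo.ext_lo_hi {f g : IncHomeo} (h : ∀ x, f (lo x) = g (lo x))
    (h' : ∀ x, f (hi x) = g (hi x)) : f = g := by
  refine IncHomeo.ext' fun x => ?_
  obtain ⟨x, rfl⟩ | ⟨x, rfl⟩ := lo_or_hi x
  exacts [h x, h' x]

theorem IsDyadic.half {x : ℝ} (hx : IsDyadic x) : IsDyadic (x / 2) := by
  simpa [div_eq_inv_mul] using hx.zpow_mul (-1)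

theorem isDyadic_one : IsDyadic 1 := ⟨1, 0, by simp⟩

theorem exists_eq_lo {y : 𝕀} (h : y ≤ lo ⊤) : ∃ x, y = lo x := by
  obtain h' | ⟨x, rfl⟩ := lo_or_hi y
  · exact h'
  · obtain ⟨rfl, -⟩ := eq_top_bot_of_hi_le_lo h
    exact ⟨⊤, lo_top.symm⟩

theorem exists_eq_hi {y : 𝕀} (h : lo ⊤ ≤ y) : ∃ x, y = hi x := by
  obtain ⟨x, rfl⟩ | h' := lo_or_hi y
  · obtain rfl : x = ⊤ := top_le_iff.1 (lo_le_lo.1 h)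
    exact ⟨⊥, lo_top⟩
  · exact h'

theorem IncHomeo.IsDyadicPL.pair {f g : IncHomeo} (hf : f.IsDyadicPL) (hg : g.IsDyadicPL) :
    (IncHomeo.pair f g).IsDyadicPL := by
  classical
  obtain ⟨B, hB, h⟩ := hf
  obtain ⟨C, hC, h'⟩ := hg
  refine ⟨insert (lo ⊤) (B.image lo ∪ C.image hi), ?_, ?_⟩
  · intro x hx
    simp only [Finset.mem_insert, Finset.mem_union, Finset.mem_image] at hx
    obtain rfl | ⟨x, hx, rfl⟩ | ⟨x, hx, rfl⟩ := hx
    · exact isDyadic_one.half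
    · exact (hB x hx).half
    · exact (isDyadic_one.add (hC x hx)).half
  · intro a b hab hfree
    have hm : ¬ (a < lo ⊤ ∧ lo ⊤ < b) := hfree _ (by simp)
    rw [not_and_or, not_lt, not_lt] at hm
    obtain ha | hb := hm
    · obtain ⟨a, rfl⟩ := exists_eq_hi ha
      obtain ⟨b, rfl⟩ := exists_eq_hi (ha.trans hab.le)
      obtain ⟨k, hk⟩ := h' a b (hi_strictMono.lt_iff_lt.1 hab) fun x hx hx' =>
        hfree (hi x) (by simp only [Finset.mem_insert, Finset.mem_union, Finset.mem_image]; grind)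
          ⟨hi_strictMono hx'.1, hi_strictMono hx'.2⟩
      refine ⟨k, fun x hax hxb => ?_⟩
      obtain ⟨x, rfl⟩ := exists_eq_hi (ha.trans hax)
      have := hk x (hi_le_hi.1 hax) (hi_le_hi.1 hxb)
      simp only [pair_hi, coe_hi]
      linarith
    · obtain ⟨b, rfl⟩ := exists_eq_lo hb
      obtain ⟨a, rfl⟩ := exists_eq_lo (hab.le.trans hb)
      obtain ⟨k, hk⟩ := h a b (lo_strictMono.lt_iff_lt.1 hab) fun x hx hx' =>
        hfree (lo x) (by simp only [Finset.mem_insert, Finset.mem_union, Finset.mem_image]; grind)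
          ⟨lo_strictMono hx'.1, lo_strictMono hx'.2⟩
      refine ⟨k, fun x hax hxb => ?_⟩
      obtain ⟨x, rfl⟩ := exists_eq_lo (hxb.trans hb)
      have := hk x (lo_le_lo.1 hax) (lo_le_lo.1 hxb)
      simp only [pair_lo, coe_lo]
      linarith

/-- The homeomorphism with slopes `1/2`, `1`, `2` on `[0, 1/2]`, `[1/2, 3/4]`, `[3/4, 1]`. -/
noncomputable def IncHomeo.x₀ : IncHomeo :=
  Equiv.toOrderIso
    -- The slopes increase, so the map is the maximum of its three affine pieces, and its concave
    -- inverse is the minimum of theirs.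
    { toFun := fun x => ⟨max (max (x / 2) (x - 1 / 4)) (2 * x - 1), by
        have := x.2.1
        have := x.2.2
        constructor
        · exact le_max_of_le_left (le_max_of_le_left (by linarith))
        · exact max_le (max_le (by linarith) (by linarith)) (by linarith)⟩
      invFun := fun x => ⟨min (min (2 * x) (x + 1 / 4)) ((1 + x) / 2), by
        have := x.2.1
        have := x.2.2
        constructor
        · exact le_min (le_min (by linarith) (by linarith)) (by linarith)
        · exact min_le_of_right_le (by linarith)⟩
      left_inv := fun x => Subtype.ext (by dsimp only; grind)
      right_inv := fun x => Subtype.ext (by dsimp only; grind) }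
    (fun x y h => by
      have h : (x : ℝ) ≤ y := h
      change max (max ((x : ℝ) / 2) (x - 1 / 4)) (2 * x - 1) ≤
        max (max ((y : ℝ) / 2) (y - 1 / 4)) (2 * y - 1)
      exact max_le_max (max_le_max (by linarith) (by linarith)) (by linarith))
    (fun x y h => by
      have h : (x : ℝ) ≤ y := h
      change min (min (2 * (x : ℝ)) (x + 1 / 4)) ((1 + x) / 2) ≤
        min (min (2 * (y : ℝ)) (y + 1 / 4)) ((1 + y) / 2)
      exact min_le_min (min_le_min (by linarith) (by linarith)) (by linarith))

theorem IncHomeo.coe_x₀ (x : 𝕀) : 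
    (x₀ x : ℝ) = max (max ((x : ℝ) / 2) (x - 1 / 4)) (2 * x - 1) := rfl

theorem IncHomeo.x₀_lo (x : 𝕀) : x₀ (lo x) = lo (lo x) := Subtype.ext <| by
  have := x.2.2
  rw [coe_x₀, coe_lo, coe_lo, coe_lo]
  grind

theorem IncHomeo.x₀_hi_lo (x : 𝕀) : x₀ (hi (lo x)) = lo (hi x) := Subtype.ext <| by
  have := x.2.1
  have := x.2.2
  rw [coe_x₀, coe_hi, coe_lo, coe_lo, coe_hi]
  grind

theorem IncHomeo.x₀_hi_hi (x : 𝕀) : x₀ (hi (hi x)) = hi x := Subtype.ext <| by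
  have := x.2.1
  rw [coe_x₀, coe_hi, coe_hi]
  grind

theorem IncHomeo.isDyadicPL_x₀ : x₀.IsDyadicPL := by
  classical
  refine ⟨{lo ⊤, hi (lo ⊤)}, ?_, ?_⟩
  · intro x hx
    simp only [Finset.mem_insert, Finset.mem_singleton] at hx
    obtain rfl | rfl := hx
    · exact isDyadic_one.half
    · exact (isDyadic_one.add isDyadic_one.half).half
  · intro a b hab hfree
    have h1 := hfree (lo ⊤) (by simp)
    have h2 := hfree (hi (lo ⊤)) (by simp)
    have ht : ((⊤ : 𝕀) : ℝ) = 1 := rfl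
    rw [not_and_or, not_lt, not_lt, ← Subtype.coe_le_coe, ← Subtype.coe_le_coe] at h1 h2
    simp only [coe_lo, coe_hi, ht] at h1 h2
    have hab' : (a : ℝ) < b := hab
    rcases h1 with h1 | h1
    · rcases h2 with h2 | h2
      · refine ⟨1, fun x hax hxb => ?_⟩
        have hax : (a : ℝ) ≤ x := hax
        rw [coe_x₀, coe_x₀, zpow_one, max_eq_right (max_le (by linarith) (by linarith)),
          max_eq_right (max_le (by linarith) (by linarith))]
        ring
      · refine ⟨0, fun x hax hxb => ?_⟩
        have hax : (a : ℝ) ≤ x := hax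
        have hxb : (x : ℝ) ≤ b := hxb
        rw [coe_x₀, coe_x₀, zpow_zero, max_eq_left (le_max_of_le_right (by linarith)),
          max_eq_left (le_max_of_le_right (by linarith)), max_eq_right (by linarith),
          max_eq_right (by linarith)]
        ring
    · refine ⟨-1, fun x hax hxb => ?_⟩
      have hax : (a : ℝ) ≤ x := hax
      have hxb : (x : ℝ) ≤ b := hxb
      rw [coe_x₀, coe_x₀, zpow_neg_one, max_eq_left (le_max_of_le_left (by linarith)),
        max_eq_left (le_max_of_le_left (by linarith)), max_eq_left (by linarith),
        max_eq_left (by linarith)]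
      ring

/-! ### The embedding of `F × F` and the infinite sequence of generators -/

namespace ThompsonF

instance : CoeFun ThompsonF fun _ => 𝕀 → 𝕀 := ⟨fun f => (f : IncHomeo)⟩

theorem ext' {f g : ThompsonF} (h : ∀ x, f x = g x) : f = g := Subtype.ext (IncHomeo.ext' h)

theorem ext_lo_hi {f g : ThompsonF} (h : ∀ x, f (lo x) = g (lo x))
    (h' : ∀ x, f (hi x) = g (hi x)) : f = g := Subtype.ext (IncHomeo.ext_lo_hi h h')

@[simp] theorem mul_apply (f g : ThompsonF) (x : 𝕀) : (f * g : ThompsonF) x = f (g x) := rfl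

@[simp] theorem one_apply (x : 𝕀) : (1 : ThompsonF) x = x := rfl

@[simp] theorem inv_apply_self (f : ThompsonF) (x : 𝕀) : (f⁻¹ : ThompsonF) (f x) = x :=
  (f : IncHomeo).inv_apply_self x

@[simp] theorem apply_inv_self (f : ThompsonF) (x : 𝕀) : f ((f⁻¹ : ThompsonF) x) = x :=
  (f : IncHomeo).apply_inv_self x

theorem strictMono (f : ThompsonF) : StrictMono f := (f : IncHomeo).strictMono

@[simp] theorem apply_bot (f : ThompsonF) : f ⊥ = ⊥ := (f : IncHomeo).map_bot

@[simp] theorem apply_top (f : ThompsonF) : f ⊤ = ⊤ := (f : IncHomeo).map_top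

/-- The embedding of `F × F` into `F`, the factors acting on the two halves of `[0, 1]`. -/
noncomputable def pair : ThompsonF × ThompsonF →* ThompsonF where
  toFun p := ⟨IncHomeo.pair p.1 p.2, p.1.2.pair p.2.2⟩
  map_one' := ext_lo_hi (fun x => IncHomeo.pair_lo 1 1 x) (fun x => IncHomeo.pair_hi 1 1 x)
  map_mul' p q := ext_lo_hi
    (fun x => by simp only [mul_apply, IncHomeo.pair_lo, Prod.fst_mul])
    (fun x => by simp only [mul_apply, IncHomeo.pair_hi, Prod.snd_mul])

@[simp] theorem pair_lo (p : ThompsonF × ThompsonF) (x : 𝕀) : pair p (lo x) = lo (p.1 x) :=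
  IncHomeo.pair_lo _ _ x

@[simp] theorem pair_hi (p : ThompsonF × ThompsonF) (x : 𝕀) : pair p (hi x) = hi (p.2 x) :=
  IncHomeo.pair_hi _ _ x

theorem pair_injective : Function.Injective pair := by
  intro p q h
  refine Prod.ext (ext' fun x => lo_injective ?_) (ext' fun x => hi_injective ?_)
  · rw [← pair_lo, ← pair_lo, h]
  · rw [← pair_hi, ← pair_hi, h]

/-- The endomorphism of `F` that lets `F` act on the upper half of `[0, 1]`. -/
noncomputable def shift : ThompsonF →* ThompsonF := pair.comp (MonoidHom.inr _ _)

@[simp] theorem shift_lo (f : ThompsonF) (x : 𝕀) : shift f (lo x) = lo x := pair_lo (1, f) x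

@[simp] theorem shift_hi (f : ThompsonF) (x : 𝕀) : shift f (hi x) = hi (f x) := pair_hi (1, f) x

theorem shift_injective : Function.Injective shift :=
  pair_injective.comp fun f g h => by simpa using h

/-- The generators `x₀, x₁, x₂, …` of Thompson's group. -/
noncomputable def gen : ℕ → ThompsonF
  | 0 => ⟨IncHomeo.x₀, IncHomeo.isDyadicPL_x₀⟩
  | n + 1 => shift (gen n)

theorem gen_zero_lo (x : 𝕀) : gen 0 (lo x) = lo (lo x) := IncHomeo.x₀_lo x

theorem gen_zero_hi_lo (x : 𝕀) : gen 0 (hi (lo x)) = lo (hi x) := IncHomeo.x₀_hi_lo x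

theorem gen_zero_hi_hi (x : 𝕀) : gen 0 (hi (hi x)) = hi x := IncHomeo.x₀_hi_hi x

theorem gen_succ (n : ℕ) : gen (n + 1) = shift (gen n) := rfl

/-- `gen 0` carries the upper quarter affinely onto the upper half, so it conjugates the action on
the one into the action on the other. Elsewhere both shifted maps are trivial. -/
theorem shift_mul_gen_zero (f : ThompsonF) : shift f * gen 0 = gen 0 * shift (shift f) := by
  refine ext_lo_hi (fun x => ?_) (fun x => ?_)
  · simp [gen_zero_lo]
  · obtain ⟨x, rfl⟩ | ⟨x, rfl⟩ := lo_or_hi x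
    · simp [gen_zero_hi_lo]
    · simp [gen_zero_hi_hi]

theorem gen_mul_gen {k n : ℕ} (h : k < n) : gen n * gen k = gen k * gen (n + 1) := by
  induction k generalizing n with
  | zero =>
    obtain ⟨n, rfl⟩ := Nat.exists_eq_add_of_lt h
    rw [Nat.zero_add, gen_succ, gen_succ (n + 1), gen_succ, shift_mul_gen_zero]
  | succ k ih =>
    obtain ⟨n, rfl⟩ : ∃ m, n = m + 1 := ⟨n - 1, by omega⟩
    rw [gen_succ, gen_succ, gen_succ (n + 1), ← map_mul, ← map_mul, ih (by omega)]

/-! ### Slopes -/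

/-- Along the filter `l` of neighbourhoods of `p`, the map `f` is affine with slope `2 ^ k`. -/
def SlopeAlong (f : ThompsonF) (p : 𝕀) (l : Filter 𝕀) (k : ℤ) : Prop :=
  ∀ᶠ x in l, (f x : ℝ) = f p + (2 : ℝ) ^ k * (x - p)

theorem continuous (f : ThompsonF) : Continuous f := OrderIso.continuous (f : IncHomeo)

theorem tendsto_nhdsGT (f : ThompsonF) (p : 𝕀) : Tendsto f (𝓝[>] p) (𝓝[>] (f p)) :=
  tendsto_nhdsWithin_of_tendsto_nhds_of_eventually_within _
    ((continuous f).continuousAt.tendsto.mono_left inf_le_left)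
    (by filter_upwards [self_mem_nhdsWithin] with x hx using strictMono f hx)

theorem tendsto_nhdsLT (f : ThompsonF) (p : 𝕀) : Tendsto f (𝓝[<] p) (𝓝[<] (f p)) :=
  tendsto_nhdsWithin_of_tendsto_nhds_of_eventually_within _
    ((continuous f).continuousAt.tendsto.mono_left inf_le_left)
    (by filter_upwards [self_mem_nhdsWithin] with x hx using strictMono f hx)

theorem exists_slopeAlong_nhdsGT (f : ThompsonF) {p : 𝕀} (hp : p < ⊤) :
    ∃ k, SlopeAlong f p (𝓝[>] p) k := by
  have : (𝓝[>] p).NeBot := nhdsGT_neBot_of_exists_gt ⟨_, hp⟩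
  obtain ⟨B, -, h⟩ := f.2
  have h1 : ∀ᶠ b in 𝓝[>] p, ∀ x ∈ B, ¬ (p < x ∧ x < b) := by
    refine (Finset.eventually_all B).2 fun x _ => ?_
    rcases le_or_gt x p with hx | hx
    · exact Eventually.of_forall fun b hb => hx.not_gt hb.1
    · filter_upwards [Ioo_mem_nhdsGT hx] with b hb hb' using hb.2.not_gt hb'.2
  obtain ⟨b, hb, hpb⟩ := (h1.and self_mem_nhdsWithin).exists
  obtain ⟨k, hk⟩ := h p b hpb hb
  refine ⟨k, ?_⟩
  filter_upwards [Ioo_mem_nhdsGT hpb] with x hx using hk x hx.1.le hx.2.le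

theorem exists_slopeAlong_nhdsLT (f : ThompsonF) {p : 𝕀} (hp : ⊥ < p) :
    ∃ k, SlopeAlong f p (𝓝[<] p) k := by
  have : (𝓝[<] p).NeBot := nhdsLT_neBot_of_exists_lt ⟨_, hp⟩
  obtain ⟨B, -, h⟩ := f.2
  have h1 : ∀ᶠ b in 𝓝[<] p, ∀ x ∈ B, ¬ (b < x ∧ x < p) := by
    refine (Finset.eventually_all B).2 fun x _ => ?_
    rcases le_or_gt p x with hx | hx
    · exact Eventually.of_forall fun b hb => hx.not_gt hb.2
    · filter_upwards [Ioo_mem_nhdsLT hx] with b hb hb' using hb.1.not_gt hb'.1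
  obtain ⟨b, hb, hpb⟩ := (h1.and self_mem_nhdsWithin).exists
  obtain ⟨k, hk⟩ := h b p hpb hb
  refine ⟨k, ?_⟩
  filter_upwards [Ioo_mem_nhdsLT hpb] with x hx
  linarith [hk x hx.1.le hx.2.le, hk p (le_of_lt hpb) le_rfl]

theorem SlopeAlong.unique {f : ThompsonF} {p : 𝕀} {l : Filter 𝕀} [l.NeBot]
    (hl : ∀ᶠ x in l, x ≠ p) {k m : ℤ} (hk : SlopeAlong f p l k) (hm : SlopeAlong f p l m) :
    k = m := by
  obtain ⟨x, hx, h1, h2⟩ := (hl.and (hk.and hm)).exists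
  have hx : (x : ℝ) - p ≠ 0 := fun h => hx (Subtype.ext (by linarith))
  have : (2 : ℝ) ^ k = 2 ^ m := mul_right_cancel₀ hx (by linarith)
  exact zpow_right_injective₀ (by norm_num) (by norm_num) this

theorem SlopeAlong.mul {f g : ThompsonF} {p : 𝕀} {l l' : Filter 𝕀} {k m : ℤ}
    (hf : SlopeAlong f (g p) l' m) (hg : SlopeAlong g p l k) (h : Tendsto g l l') :
    SlopeAlong (f * g) p l (m + k) := by
  filter_upwards [hg, h.eventually hf] with x h1 h2
  rw [mul_apply, h2, h1, mul_apply, zpow_add₀ two_ne_zero]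
  ring

/-- The chain rule makes the logarithm of the slope additive; `hl` makes it well defined. -/
theorem exists_slopeHom {G : Type*} [Group G] (ρ : G →* ThompsonF) {p : 𝕀} {l : Filter 𝕀}
    [l.NeBot] (hl : ∀ᶠ x in l, x ≠ p) (hp : ∀ g, ρ g p = p) (ht : ∀ g, Tendsto (ρ g) l l)
    (he : ∀ g, ∃ k, SlopeAlong (ρ g) p l k) :
    ∃ ψ : G →* Multiplicative ℤ, ∀ g, SlopeAlong (ρ g) p l (ψ g).toAdd := by
  choose k hk using he
  refine ⟨MonoidHom.mk' (fun g => Multiplicative.ofAdd (k g)) fun a b => ?_, hk⟩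
  rw [← ofAdd_add]
  refine congrArg _ ((hk (a * b)).unique hl ?_)
  rw [map_mul]
  exact SlopeAlong.mul (by rw [hp b]; exact hk a) (hk b) (ht b)

theorem eventually_nhdsGT_ne (p : 𝕀) : ∀ᶠ x in 𝓝[>] p, x ≠ p := by
  filter_upwards [self_mem_nhdsWithin] with x hx using hx.ne'

theorem eventually_nhdsLT_ne (p : 𝕀) : ∀ᶠ x in 𝓝[<] p, x ≠ p := by
  filter_upwards [self_mem_nhdsWithin] with x hx using hx.ne

theorem bot_lt_top : (⊥ : 𝕀) < ⊤ := Subtype.mk_lt_mk.2 zero_lt_one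

instance : (𝓝[>] (⊥ : 𝕀)).NeBot := nhdsGT_neBot_of_exists_gt ⟨_, bot_lt_top⟩

instance : (𝓝[<] (⊤ : 𝕀)).NeBot := nhdsLT_neBot_of_exists_lt ⟨_, bot_lt_top⟩

theorem exists_slopeHom_bot :
    ∃ ψ : ThompsonF →* Multiplicative ℤ, ∀ g, SlopeAlong g ⊥ (𝓝[>] ⊥) (ψ g).toAdd :=
  exists_slopeHom (MonoidHom.id _) (eventually_nhdsGT_ne _) apply_bot
    (fun g => by simpa using tendsto_nhdsGT g ⊥) fun g => exists_slopeAlong_nhdsGT g bot_lt_top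

theorem exists_slopeHom_top :
    ∃ ψ : ThompsonF →* Multiplicative ℤ, ∀ g, SlopeAlong g ⊤ (𝓝[<] ⊤) (ψ g).toAdd :=
  exists_slopeHom (MonoidHom.id _) (eventually_nhdsLT_ne _) apply_top
    (fun g => by simpa using tendsto_nhdsLT g ⊤) fun g => exists_slopeAlong_nhdsLT g bot_lt_top

/-- The logarithm of the slope at `0`. -/
noncomputable def slopeBot : ThompsonF →* Multiplicative ℤ := exists_slopeHom_bot.choose

/-- The logarithm of the slope at `1`. -/
noncomputable def slopeTop : ThompsonF →* Multiplicative ℤ := exists_slopeHom_top.choose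

theorem slopeAlong_slopeBot (g : ThompsonF) : SlopeAlong g ⊥ (𝓝[>] ⊥) (slopeBot g).toAdd :=
  exists_slopeHom_bot.choose_spec g

theorem slopeAlong_slopeTop (g : ThompsonF) : SlopeAlong g ⊤ (𝓝[<] ⊤) (slopeTop g).toAdd :=
  exists_slopeHom_top.choose_spec g

theorem SlopeAlong.slopeBot_eq {f : ThompsonF} {k : ℤ} (h : SlopeAlong f ⊥ (𝓝[>] ⊥) k) :
    slopeBot f = Multiplicative.ofAdd k :=
  (slopeAlong_slopeBot f).unique (eventually_nhdsGT_ne _) h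

theorem SlopeAlong.slopeTop_eq {f : ThompsonF} {k : ℤ} (h : SlopeAlong f ⊤ (𝓝[<] ⊤) k) :
    slopeTop f = Multiplicative.ofAdd k :=
  (slopeAlong_slopeTop f).unique (eventually_nhdsLT_ne _) h

theorem slopeBot_shift (f : ThompsonF) : slopeBot (shift f) = 1 := by
  refine SlopeAlong.slopeBot_eq (k := 0) ?_
  have : (⊥ : 𝕀) < lo ⊤ := by
    rw [← lo_bot]
    exact lo_strictMono bot_lt_top
  filter_upwards [Ioo_mem_nhdsGT this] with x hx
  obtain ⟨x, rfl⟩ := exists_eq_lo hx.2.le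
  simp

theorem slopeBot_gen_zero : slopeBot (gen 0) = Multiplicative.ofAdd (-1) := by
  refine SlopeAlong.slopeBot_eq ?_
  have : (⊥ : 𝕀) < lo ⊤ := by
    rw [← lo_bot]
    exact lo_strictMono bot_lt_top
  filter_upwards [Ioo_mem_nhdsGT this] with x hx
  obtain ⟨x, rfl⟩ := exists_eq_lo hx.2.le
  have h0 : ((⊥ : 𝕀) : ℝ) = 0 := rfl
  rw [gen_zero_lo, apply_bot, zpow_neg_one, h0, coe_lo]
  ring

/-! ### The cells of the vine -/

/-- The affine bijection from `[0, 1]` to the interval `[1 - 2⁻ʲ, 1 - 2⁻ʲ⁻¹]`. -/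
noncomputable def cell : ℕ → 𝕀 → 𝕀
  | 0 => lo
  | j + 1 => hi ∘ cell j

theorem cell_zero (x : 𝕀) : cell 0 x = lo x := rfl

theorem cell_succ (j : ℕ) (x : 𝕀) : cell (j + 1) x = hi (cell j x) := rfl

theorem coe_cell (j : ℕ) (x : 𝕀) : (cell j x : ℝ) = (2 ^ (j + 1) - 2 + x) / 2 ^ (j + 1) := by
  induction j with
  | zero => simp [cell_zero]
  | succ j ih =>
    rw [cell_succ, coe_hi, ih]
    field_simp
    ring

theorem cell_top (j : ℕ) : cell j ⊤ = cell (j + 1) ⊥ := by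
  induction j with
  | zero => rw [cell_zero, lo_top, cell_succ, cell_zero, lo_bot]
  | succ j ih => rw [cell_succ, ih, cell_succ (j + 1)]

theorem exists_lt_cell {y : 𝕀} (hy : y < ⊤) : ∃ j, y < cell j ⊥ := by
  have h1 : (0 : ℝ) < 1 - y := sub_pos.2 hy
  obtain ⟨n, hn⟩ := exists_pow_lt_of_lt_one h1 (by norm_num : (1 / 2 : ℝ) < 1)
  refine ⟨n, ?_⟩
  have h0 : ((⊥ : 𝕀) : ℝ) = 0 := rfl
  rw [← Subtype.coe_lt_coe, coe_cell, h0, add_zero, lt_div_iff₀ (by positivity)]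
  rw [div_pow, one_pow, div_lt_iff₀ (by positivity)] at hn
  rw [pow_succ]
  linarith

theorem cell_strictMono (j : ℕ) : StrictMono (cell j) := by
  induction j with
  | zero => exact lo_strictMono
  | succ j ih => exact hi_strictMono.comp ih

theorem cell_bot_strictMono : StrictMono fun j => cell j ⊥ := by
  refine strictMono_nat_of_lt_succ fun j => ?_
  rw [← cell_top]
  exact cell_strictMono j bot_lt_top

theorem exists_eq_cell {y : 𝕀} (hy : y < ⊤) : ∃ j x, y = cell j x := by
  obtain ⟨n, hn⟩ := exists_lt_cell hy
  clear hy
  induction n generalizing y with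
  | zero =>
    rw [cell_zero, lo_bot] at hn
    exact absurd hn not_lt_bot
  | succ n ih =>
    obtain ⟨x, rfl⟩ | ⟨x, rfl⟩ := lo_or_hi y
    · exact ⟨0, x, rfl⟩
    · obtain ⟨j, z, rfl⟩ := ih (hi_strictMono.lt_iff_lt.1 hn)
      exact ⟨j + 1, z, rfl⟩

/-- This and the next three lemmas show that `gen i` squeezes cells `i` and `i + 1` into the two
halves of cell `i` and moves later cells back by one. Hence right multiplication by `gen i` bisects
the image of cell `i` and renumbers what follows. -/
theorem gen_cell_of_lt {i j : ℕ} (h : j < i) (x : 𝕀) : gen i (cell j x) = cell j x := by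
  induction i generalizing j with
  | zero => omega
  | succ i ih =>
    cases j with
    | zero => rw [gen_succ, cell_zero, shift_lo]
    | succ j => rw [gen_succ, cell_succ, shift_hi, ih (by omega)]

theorem gen_cell_self (i : ℕ) (x : 𝕀) : gen i (cell i x) = cell i (lo x) := by
  induction i with
  | zero => exact gen_zero_lo x
  | succ i ih => rw [gen_succ, cell_succ, shift_hi, ih, cell_succ]

theorem gen_cell_succ_self (i : ℕ) (x : 𝕀) : gen i (cell (i + 1) x) = cell i (hi x) := by
  induction i with
  | zero => exact gen_zero_hi_lo x
  | succ i ih => rw [gen_succ, cell_succ, shift_hi, ih, cell_succ]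

theorem gen_cell_of_gt {i j : ℕ} (h : i < j) (x : 𝕀) : gen i (cell (j + 1) x) = cell j x := by
  induction i generalizing j with
  | zero =>
    obtain ⟨j, rfl⟩ := Nat.exists_eq_add_of_lt h
    rw [Nat.zero_add]
    exact gen_zero_hi_hi _
  | succ i ih =>
    obtain ⟨j, rfl⟩ : ∃ m, j = m + 1 := ⟨j - 1, by omega⟩
    rw [gen_succ, cell_succ, shift_hi, ih (by omega), cell_succ]

theorem slopeTop_gen (i : ℕ) : slopeTop (gen i) = Multiplicative.ofAdd 1 := by
  refine SlopeAlong.slopeTop_eq ?_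
  have h1 : ((⊤ : 𝕀) : ℝ) = 1 := rfl
  have hlt : cell (i + 2) ⊥ < ⊤ := (cell_bot_strictMono (Nat.lt_succ_self _)).trans_le le_top
  filter_upwards [Ioo_mem_nhdsLT hlt] with x hx
  obtain ⟨j, x, rfl⟩ := exists_eq_cell hx.2
  have hj : i + 1 < j := by
    by_contra! hj
    have h2 := hx.1.trans_le ((cell_strictMono j).monotone le_top)
    rw [cell_top] at h2
    exact (cell_bot_strictMono.monotone (by omega : j + 1 ≤ i + 2)).not_gt h2
  obtain ⟨j, rfl⟩ : ∃ m, j = m + 1 := ⟨j - 1, by omega⟩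
  rw [gen_cell_of_gt (by omega), apply_top, coe_cell, coe_cell, h1]
  field_simp
  ring

/-! ### Maps that are standard on the cells -/

/-- The map `f` sends the `j`-th cell affinely to the standard dyadic interval
`[a / 2 ^ l, (a + 1) / 2 ^ l]`. -/
def CellTo (f : ThompsonF) (j a l : ℕ) : Prop := ∀ x, (f (cell j x) : ℝ) = (a + x) / 2 ^ l

theorem cellTo_one (j : ℕ) : CellTo 1 j (2 ^ (j + 1) - 2) (j + 1) := by
  intro x
  rw [one_apply, coe_cell, Nat.cast_sub]
  · simp
  · exact Nat.le_self_pow (by omega) 2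

theorem CellTo.mul_gen_of_lt {f : ThompsonF} {i j a l : ℕ} (h : CellTo f j a l) (hj : j < i) :
    CellTo (f * gen i) j a l := fun x => by
  rw [mul_apply, gen_cell_of_lt hj, h]

theorem CellTo.mul_gen_self {f : ThompsonF} {i a l : ℕ} (h : CellTo f i a l) :
    CellTo (f * gen i) i (2 * a) (l + 1) := fun x => by
  rw [mul_apply, gen_cell_self, h, coe_lo]
  push_cast
  field_simp
  ring

theorem CellTo.mul_gen_succ_self {f : ThompsonF} {i a l : ℕ} (h : CellTo f i a l) :
    CellTo (f * gen i) (i + 1) (2 * a + 1) (l + 1) := fun x => by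
  rw [mul_apply, gen_cell_succ_self, h, coe_hi]
  push_cast
  field_simp
  ring

theorem CellTo.mul_gen_of_gt {f : ThompsonF} {i j a l : ℕ} (h : CellTo f j a l) (hj : i < j) :
    CellTo (f * gen i) (j + 1) a l := fun x => by
  rw [mul_apply, gen_cell_of_gt hj, h]

/-- Merging the cells `i` and `i + 1`, whose images are the halves of a standard interval. -/
theorem exists_cellTo_mul_gen_inv {f : ThompsonF} {i a l : ℕ} (hf : ∀ j, ∃ a l, CellTo f j a l)
    (h : CellTo f i (2 * a) (l + 1)) (h' : CellTo f (i + 1) (2 * a + 1) (l + 1)) (j : ℕ) :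
    ∃ a l, CellTo (f * (gen i)⁻¹) j a l := by
  rcases lt_trichotomy j i with hj | rfl | hj
  · obtain ⟨b, m, hb⟩ := hf j
    refine ⟨b, m, fun x => ?_⟩
    rw [mul_apply, ← gen_cell_of_lt hj, inv_apply_self, hb]
  · refine ⟨a, l, fun x => ?_⟩
    obtain ⟨x, rfl⟩ | ⟨x, rfl⟩ := lo_or_hi x
    · rw [mul_apply, ← gen_cell_self, inv_apply_self, h, coe_lo]
      push_cast
      field_simp
      ring
    · rw [mul_apply, ← gen_cell_succ_self, inv_apply_self, h', coe_hi]
      push_cast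
      field_simp
      ring
  · obtain ⟨b, m, hb⟩ := hf (j + 1)
    refine ⟨b, m, fun x => ?_⟩
    rw [mul_apply, ← gen_cell_of_gt hj, inv_apply_self, hb]

/-- Consecutive standard dyadic intervals `[a j / 2 ^ l j, (a j + 1) / 2 ^ l j]` that exhaust
`[0, 1)` and of which no two consecutive ones are siblings are the cells of the vine. -/
theorem eq_vine_of_no_siblings {a l : ℕ → ℕ} (h0 : a 0 = 0)
    (hs : ∀ j, (a j + 1) * 2 ^ l (j + 1) = a (j + 1) * 2 ^ l j) (hlt : ∀ j, a j + 2 ≤ 2 ^ l j)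
    (hlim : ∀ y : ℝ, y < 1 → ∀ N, ∃ j ≥ N, y < a j / 2 ^ l j)
    (hns : ∀ j, Even (a j) → l (j + 1) ≠ l j) (j : ℕ) : l j = j + 1 ∧ a j + 2 = 2 ^ (j + 1) := by
  -- For even `a j`, the common endpoint `(a j + 1) / 2 ^ l j` is in lowest terms, so the level
  -- cannot drop. It cannot stay the same either, since the two intervals would be siblings.
  have hev : ∀ j, Even (a j) → l j < l (j + 1) := by
    intro j hj
    refine lt_of_le_of_ne ?_ (hns j hj).symm
    have hodd : Odd (a j + 1) := hj.add_one
    have hc : Nat.Coprime (2 ^ l j) (a j + 1) :=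
      Nat.Coprime.pow_left _ (Nat.coprime_two_left.2 hodd)
    have : 2 ^ l j ∣ 2 ^ l (j + 1) := hc.dvd_of_dvd_mul_left ⟨a (j + 1), by rw [hs]; ring⟩
    exact (Nat.pow_dvd_pow_iff_le_right (by norm_num)).1 this
  have heven : ∀ j, Even (a j) := by
    intro j
    induction j with
    | zero => simp [h0]
    | succ j ih =>
      obtain ⟨d, hd⟩ := Nat.exists_eq_add_of_lt (hev j ih)
      have := hs j
      rw [hd, show l j + d + 1 = l j + (d + 1) by omega, pow_add, mul_comm (2 ^ l j), ← mul_assoc]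
        at this
      rw [← Nat.eq_of_mul_eq_mul_right (by positivity) this, pow_succ, ← mul_assoc]
      exact even_two.mul_left _
  have hinc : ∀ j, l j + 1 ≤ l (j + 1) := fun j => hev j (heven j)
  have hs' : ∀ j, ((a j : ℝ) + 1) / 2 ^ l j = a (j + 1) / 2 ^ l (j + 1) := by
    intro j
    rw [div_eq_div_iff (by positivity) (by positivity)]
    exact_mod_cast hs j
  -- For even `a j` this is the right end of the parent interval. These ends decrease, while the
  -- intervals approach `1`, so all of them equal `1`.
  have hanti : Antitone fun j => ((a j : ℝ) + 2) / 2 ^ l j := by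
    refine antitone_nat_of_succ_le fun j => ?_
    have h1 : ((2 : ℝ) ^ l (j + 1))⁻¹ ≤ (2 ^ (l j + 1))⁻¹ := by
      gcongr
      · norm_num
      · exact hinc j
    have h2 : ((2 : ℝ) ^ (l j + 1))⁻¹ = (2 ^ l j)⁻¹ / 2 := by
      rw [pow_succ, mul_inv]
      ring
    have h3 := hs' j
    simp only [div_eq_mul_inv, add_mul] at h3 ⊢
    linarith
  have hone : ∀ j, a j + 2 = 2 ^ l j := by
    intro j
    refine le_antisymm (hlt j) ?_
    by_contra! h
    have h : ((a j : ℝ) + 2) / 2 ^ l j < 1 := by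
      rw [div_lt_one (by positivity)]
      exact_mod_cast h
    obtain ⟨k, hk, hlt'⟩ := hlim _ h j
    have h2 : ((a k : ℝ) + 2) / 2 ^ l k ≤ (a j + 2) / 2 ^ l j := hanti hk
    have h3 : (a k : ℝ) / 2 ^ l k ≤ (a k + 2) / 2 ^ l k := by
      gcongr
      linarith
    linarith
  have hl : ∀ j, l j = j + 1 := by
    intro j
    induction j with
    | zero =>
      have := hone 0
      rw [h0] at this
      exact Nat.pow_right_injective (le_refl 2) (by simpa using this.symm)
    | succ j ih =>
      have h1 := hs j
      have h2 := hone j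
      have h3 := hone (j + 1)
      rw [ih] at h1 h2
      have hp : 2 ≤ 2 ^ (j + 1) := Nat.le_self_pow (by omega) 2
      obtain ⟨c, hc⟩ : ∃ c, a j = c := ⟨_, rfl⟩
      refine Nat.pow_right_injective (le_refl 2) ?_
      change 2 ^ l (j + 1) = 2 ^ (j + 1 + 1)
      rw [pow_succ 2 (j + 1)]
      generalize 2 ^ l (j + 1) = u at *
      generalize 2 ^ (j + 1) = v at *
      subst h3 h2
      nlinarith
  exact ⟨hl j, by rw [hone, hl]⟩

/-- The right end of a cell is less than `1`, hence so is the right end of its image. -/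
theorem CellTo.add_two_le {f : ThompsonF} {j a l : ℕ} (h : CellTo f j a l) : a + 2 ≤ 2 ^ l := by
  have h1 : cell j ⊤ < ⊤ := by
    rw [cell_top]
    exact (cell_bot_strictMono (Nat.lt_succ_self _)).trans_le le_top
  have h2 : (f (cell j ⊤) : ℝ) < 1 := by
    have := strictMono f h1
    rw [apply_top] at this
    exact this
  rw [h, div_lt_one (by positivity)] at h2
  have h3 : ((⊤ : 𝕀) : ℝ) = 1 := rfl
  rw [h3] at h2
  have : a + 1 < 2 ^ l := by exact_mod_cast h2
  omega

theorem exists_lt_apply_cell (f : ThompsonF) {y : ℝ} (hy : y < 1) :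
    ∃ N, ∀ j ≥ N, y < f (cell j ⊥) := by
  set z : 𝕀 := Set.projIcc 0 1 zero_le_one y with hz
  have hzt : z < ⊤ := by
    rw [← Subtype.coe_lt_coe, hz, Set.coe_projIcc]
    exact max_lt zero_lt_one (min_lt_of_right_lt hy)
  have hyz : y ≤ z := by
    rw [hz, Set.coe_projIcc, min_eq_right hy.le]
    exact le_max_right _ _
  have h1 : f⁻¹ z < ⊤ := by
    have := strictMono f⁻¹ hzt
    rwa [apply_top] at this
  obtain ⟨N, hN⟩ := exists_lt_cell h1
  refine ⟨N, fun j hj => hyz.trans_lt ?_⟩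
  have := strictMono f (hN.trans_le (cell_bot_strictMono.monotone hj))
  rw [apply_inv_self] at this
  exact this

theorem eq_one_of_cellTo {f : ThompsonF} (h : ∀ j, CellTo f j (2 ^ (j + 1) - 2) (j + 1)) :
    f = 1 := by
  refine ext' fun x => ?_
  rcases eq_or_lt_of_le (le_top : x ≤ ⊤) with rfl | hx
  · rw [apply_top, one_apply]
  · obtain ⟨j, x, rfl⟩ := exists_eq_cell hx
    exact Subtype.ext ((h j x).trans (cellTo_one j x).symm)

/-- Without siblings the images of the cells are the cells themselves by `eq_vine_of_no_siblings`,
which makes `f` the identity. -/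
theorem exists_siblings {f : ThompsonF} (hf : ∀ j, ∃ a l, CellTo f j a l) (h1 : f ≠ 1) :
    ∃ i a l, CellTo f i (2 * a) (l + 1) ∧ CellTo f (i + 1) (2 * a + 1) (l + 1) := by
  choose a l hal using hf
  have hb : ((⊥ : 𝕀) : ℝ) = 0 := rfl
  have ht : ((⊤ : 𝕀) : ℝ) = 1 := rfl
  have h0 : a 0 = 0 := by
    have := hal 0 ⊥
    rw [cell_zero, lo_bot, apply_bot, hb, eq_comm, div_eq_zero_iff] at this
    simpa using this
  have hs : ∀ j, (a j + 1) * 2 ^ l (j + 1) = a (j + 1) * 2 ^ l j := by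
    intro j
    have := hal j ⊤
    rw [cell_top, hal, hb, ht, add_zero, div_eq_div_iff (by positivity) (by positivity)] at this
    exact_mod_cast this.symm
  by_contra! hno
  refine h1 (eq_one_of_cellTo fun j => ?_)
  obtain ⟨h2, h3⟩ := eq_vine_of_no_siblings h0 hs (fun j => (hal j).add_two_le) (fun y hy N => by
      obtain ⟨M, hM⟩ := exists_lt_apply_cell f hy
      refine ⟨max M N, le_max_right _ _, ?_⟩
      have := hM _ (le_max_left M N)
      rwa [hal, hb, add_zero] at this) (fun i ⟨c, hc⟩ hl => by
      have h4 := hs i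
      rw [hl] at h4
      have h5 := Nat.eq_of_mul_eq_mul_right (by positivity) h4
      have h6 := (hal i).add_two_le
      obtain ⟨m, hm⟩ : ∃ m, l i = m + 1 := by
        refine Nat.exists_eq_succ_of_ne_zero fun h => ?_
        rw [h] at h6
        omega
      refine hno i c m ?_ ?_
      · have := hal i
        rwa [hc, ← two_mul, hm] at this
      · have := hal (i + 1)
        rwa [← h5, hc, ← two_mul, hl, hm] at this) j
  have := hal j
  rwa [h2, show a j = 2 ^ (j + 1) - 2 by omega] at this

/-- At the endpoints of the cells the graph of `f` is on or below the diagonal, so the slope at `1`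
cannot be less than `1`. -/
theorem slopeTop_nonneg {f : ThompsonF} (hf : ∀ j, ∃ a l, CellTo f j a l) :
    0 ≤ (slopeTop f).toAdd := by
  have hb : ((⊥ : 𝕀) : ℝ) = 0 := rfl
  have ht : ((⊤ : 𝕀) : ℝ) = 1 := rfl
  have hle : ∀ j, (f (cell j ⊥) : ℝ) ≤ cell j ⊥ := by
    intro j
    induction j with
    | zero => rw [cell_zero, lo_bot, apply_bot]
    | succ j ih =>
      obtain ⟨a, l, h⟩ := hf j
      -- The next image endpoint is midway between `a / 2 ^ l` and `(a + 2) / 2 ^ l ≤ 1`. The next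
      -- cell endpoint is midway between the present one and `1`.
      have h2 : (a : ℝ) + 2 ≤ 2 ^ l := by exact_mod_cast h.add_two_le
      rw [← cell_top, h, ht]
      rw [h, hb, coe_cell, hb, add_zero, div_le_div_iff₀ (by positivity) (by positivity)] at ih
      rw [coe_cell, ht, div_le_div_iff₀ (by positivity) (by positivity)]
      nlinarith
  have h1 := slopeAlong_slopeTop f
  obtain ⟨u, hu, hu'⟩ := (mem_nhdsLT_iff_exists_Ioo_subset' bot_lt_top).1 h1
  obtain ⟨j, hj⟩ := exists_lt_cell hu
  have hjt : cell j ⊥ < ⊤ := (cell_bot_strictMono (Nat.lt_succ_self _)).trans_le le_top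
  have h2 : (f (cell j ⊥) : ℝ) = f ⊤ + (2 : ℝ) ^ (slopeTop f).toAdd * (cell j ⊥ - (⊤ : 𝕀)) :=
    hu' ⟨hj, hjt⟩
  have h3 := hle j
  have h4 : (cell j ⊥ : ℝ) < 1 := hjt
  rw [apply_top, ht] at h2
  by_contra! h5
  have h6 : (2 : ℝ) ^ (slopeTop f).toAdd < 1 := zpow_lt_one_of_neg₀ (by norm_num) h5
  nlinarith

/-- Each merge of siblings lowers the log-slope at `1` by one, and it can never become negative.
This bounds the number of merges. -/
theorem mem_closure_of_cellTo {f : ThompsonF} (hf : ∀ j, ∃ a l, CellTo f j a l) :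
    f ∈ Subgroup.closure (Set.range gen) := by
  obtain ⟨n, hn⟩ := Int.eq_ofNat_of_zero_le (slopeTop_nonneg hf)
  induction n generalizing f with
  | zero =>
    by_cases h1 : f = 1
    · rw [h1]
      exact one_mem _
    · obtain ⟨i, a, l, h, h'⟩ := exists_siblings hf h1
      have := slopeTop_nonneg (exists_cellTo_mul_gen_inv hf h h')
      rw [map_mul, map_inv, slopeTop_gen, toAdd_mul, hn] at this
      simp at this
  | succ n ih =>
    by_cases h1 : f = 1
    · rw [h1]
      exact one_mem _
    · obtain ⟨i, a, l, h, h'⟩ := exists_siblings hf h1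
      have := ih (exists_cellTo_mul_gen_inv hf h h') (by
        rw [map_mul, map_inv, slopeTop_gen, toAdd_mul, hn]
        simp)
      rw [← inv_mul_cancel_right f (gen i)]
      simpa using mul_mem this (Subgroup.subset_closure ⟨i, rfl⟩)

/-- Images near `1` are short, so only finitely many cells need bisecting to raise the minimal level
by one. -/
theorem exists_refinement (m : ℕ) : ∃ q ∈ Subgroup.closure (Set.range gen),
    ∀ j, ∃ a l, m ≤ l ∧ CellTo q j a l := by
  induction m with
  | zero => exact ⟨1, one_mem _, fun j => ⟨_, _, Nat.zero_le _, cellTo_one j⟩⟩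
  | succ m ih =>
    obtain ⟨q, hq, hm⟩ := ih
    have hN : ∃ N, ∀ j ≥ N, ∃ a l, m + 1 ≤ l ∧ CellTo q j a l := by
      obtain ⟨N, hN⟩ := exists_lt_apply_cell q (y := 1 - 1 / 2 ^ m) (by simp)
      refine ⟨N, fun j hj => ?_⟩
      obtain ⟨a, l, -, h⟩ := hm j
      refine ⟨a, l, ?_, h⟩
      have h1 := hN j hj
      have h2 : (a : ℝ) + 2 ≤ 2 ^ l := by exact_mod_cast h.add_two_le
      have hb : ((⊥ : 𝕀) : ℝ) = 0 := rfl
      rw [h, hb, add_zero, lt_div_iff₀ (by positivity)] at h1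
      by_contra! hl
      have h3 : (2 : ℝ) ^ l ≤ 2 ^ m := pow_le_pow_right₀ (by norm_num) (by omega)
      have h4 : 1 / (2 : ℝ) ^ m * 2 ^ l ≤ 1 := by
        rw [div_mul_eq_mul_div, one_mul, div_le_one (by positivity)]
        exact h3
      linarith
    obtain ⟨N, hN⟩ := hN
    -- Bisecting cell `N`, of level at least `m`, yields two cells of level at least `m + 1`. The
    -- later cells are only renumbered, so the bound drops from `N + 1` to `N`.
    induction N generalizing q with
    | zero => exact ⟨q, hq, fun j => hN j (Nat.zero_le _)⟩
    | succ N ih =>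
      have hcases : ∀ j, j < N ∨ j = N ∨ j = N + 1 ∨ ∃ i, N < i ∧ j = i + 1 := by
        intro j
        rcases lt_trichotomy j N with h | h | h
        · exact Or.inl h
        · exact Or.inr (Or.inl h)
        · rcases eq_or_lt_of_le (Nat.succ_le_of_lt h) with h | h
          · exact Or.inr (Or.inr (Or.inl h.symm))
          · exact Or.inr (Or.inr (Or.inr ⟨j - 1, by omega, by omega⟩))
      refine ih (q * gen N) (mul_mem hq (Subgroup.subset_closure ⟨N, rfl⟩)) (fun j => ?_)
        (fun j hj => ?_)
      all_goals obtain hj' | rfl | rfl | ⟨i, hi, rfl⟩ := hcases j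
      · obtain ⟨a, l, hl, h⟩ := hm j
        exact ⟨a, l, hl, h.mul_gen_of_lt hj'⟩
      · obtain ⟨a, l, hl, h⟩ := hm j
        exact ⟨_, _, by omega, h.mul_gen_self⟩
      · obtain ⟨a, l, hl, h⟩ := hm N
        exact ⟨_, _, by omega, h.mul_gen_succ_self⟩
      · obtain ⟨a, l, hl, h⟩ := hm i
        exact ⟨a, l, hl, h.mul_gen_of_gt hi⟩
      · omega
      · obtain ⟨a, l, hl, h⟩ := hm j
        exact ⟨_, _, by omega, h.mul_gen_self⟩
      · obtain ⟨a, l, hl, h⟩ := hm N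
        exact ⟨_, _, by omega, h.mul_gen_succ_self⟩
      · obtain ⟨a, l, hl, h⟩ := hN i hi
        exact ⟨a, l, hl, h.mul_gen_of_gt hi⟩

theorem exists_common_denominator {ι : Type*} (s : Finset ι) (φ : ι → ℝ)
    (h : ∀ i ∈ s, IsDyadic (φ i)) : ∃ r : ℕ, ∀ i ∈ s, ∃ c : ℤ, φ i = c / 2 ^ r := by
  choose! c m hcm using h
  refine ⟨s.sup m, fun i hi => ⟨c i * 2 ^ (s.sup m - m i), ?_⟩⟩
  have hle : m i ≤ s.sup m := Finset.le_sup hi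
  rw [hcm i hi, div_eq_div_iff (by positivity) (by positivity)]
  push_cast
  rw [mul_assoc, ← pow_add, Nat.sub_add_cancel hle]

/-- Elements of `F` map all sufficiently small standard dyadic intervals affinely to standard
dyadic intervals. -/
theorem exists_level (f : ThompsonF) : ∃ M : ℕ, ∀ a l : ℕ, M ≤ l → a + 1 ≤ 2 ^ l →
    ∃ a' l' : ℕ, ∀ x y : 𝕀, (y : ℝ) = (a + x) / 2 ^ l → (f y : ℝ) = (a' + x) / 2 ^ l' := by
  obtain ⟨B, hB, h⟩ := f.2
  obtain ⟨r, hr⟩ := exists_common_denominator B (fun x => (x : ℝ)) hB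
  have hgrid : ∀ i : ℕ, i ≤ 2 ^ r → (i : ℝ) / 2 ^ r ∈ Set.Icc (0 : ℝ) 1 := by
    intro i hi
    refine ⟨by positivity, ?_⟩
    rw [div_le_one (by positivity)]
    exact_mod_cast hi
  -- The value `0` is never taken on the range considered.
  obtain ⟨s, hs⟩ := exists_common_denominator (Finset.range (2 ^ r + 1))
    (fun i => if hi : i ≤ 2 ^ r then (f ⟨(i : ℝ) / 2 ^ r, hgrid i hi⟩ : ℝ) else 0) (by
      intro i hi
      have hi : i ≤ 2 ^ r := Nat.lt_succ_iff.1 (Finset.mem_range.1 hi)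
      rw [dif_pos hi]
      exact f.2.isDyadic_apply _ ⟨i, r, by push_cast; rfl⟩)
  -- Level `r` resolves the breakpoints and `s` the values of `f` on the grid of mesh `2⁻ʳ`. A slope
  -- `2 ^ k` on a grid interval has `k ≤ r`, as the image has length at most `1`. So the image level
  -- `l - k` is at least `s`.
  refine ⟨r + s, fun a l hl ha => ?_⟩
  set i := a / 2 ^ (l - r) with hi
  set t := a % 2 ^ (l - r) with ht
  have hait : a = i * 2 ^ (l - r) + t := by rw [hi, ht, mul_comm, Nat.div_add_mod]
  have htlt : t < 2 ^ (l - r) := Nat.mod_lt _ (by positivity)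
  have hpow : 2 ^ l = 2 ^ r * 2 ^ (l - r) := by rw [← pow_add]; congr 1; omega
  have hi1 : i + 1 ≤ 2 ^ r := by
    refine Nat.succ_le_of_lt (Nat.lt_of_mul_lt_mul_right (a := 2 ^ (l - r)) ?_)
    rw [← hpow]
    omega
  have hpow' : (2 : ℝ) ^ l = 2 ^ r * 2 ^ (l - r) := by exact_mod_cast hpow
  obtain ⟨c, hc⟩ := hs i (Finset.mem_range.2 (by omega))
  rw [dif_pos (by omega)] at hc
  set g : 𝕀 := ⟨(i : ℝ) / 2 ^ r, hgrid i (by omega)⟩ with hg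
  set g' : 𝕀 := ⟨((i + 1 : ℕ) : ℝ) / 2 ^ r, hgrid (i + 1) hi1⟩ with hg'
  have hgg : g < g' := by
    rw [← Subtype.coe_lt_coe]
    change (i : ℝ) / 2 ^ r < ((i + 1 : ℕ) : ℝ) / 2 ^ r
    rw [div_lt_div_iff_of_pos_right (by positivity)]
    exact_mod_cast Nat.lt_succ_self i
  obtain ⟨k, hk⟩ := h g g' hgg (by
    rintro x hx ⟨h1, h2⟩
    obtain ⟨d, hd⟩ := hr x hx
    rw [← Subtype.coe_lt_coe, hd] at h1 h2
    change (i : ℝ) / 2 ^ r < d / 2 ^ r at h1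
    change (d : ℝ) / 2 ^ r < ((i + 1 : ℕ) : ℝ) / 2 ^ r at h2
    rw [div_lt_div_iff_of_pos_right (by positivity)] at h1 h2
    have h1 : (i : ℤ) < d := by exact_mod_cast h1
    have h2 : d < (i + 1 : ℕ) := by exact_mod_cast h2
    omega)
  have hkr : k ≤ r := by
    have h1 := hk g' hgg.le le_rfl
    have h2 : (f g' : ℝ) ≤ 1 := (f g').2.2
    have h3 : 0 ≤ (f g : ℝ) := (f g).2.1
    have h4 : (g' : ℝ) - g = 1 / 2 ^ r := by
      change ((i + 1 : ℕ) : ℝ) / 2 ^ r - i / 2 ^ r = _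
      push_cast
      ring
    rw [h4] at h1
    have h5 : (2 : ℝ) ^ k * (1 / 2 ^ r) ≤ 1 := by linarith
    rw [mul_one_div, div_le_one (by positivity), ← zpow_natCast] at h5
    exact (zpow_le_zpow_iff_right₀ (by norm_num)).1 h5
  obtain ⟨l', hl'⟩ := Int.eq_ofNat_of_zero_le (show 0 ≤ (l : ℤ) - k by omega)
  have hsl : s ≤ l' := by omega
  have hc0 : 0 ≤ c := by
    have h3 : 0 ≤ (f g : ℝ) := (f g).2.1
    rw [hc, le_div_iff₀ (by positivity), zero_mul] at h3
    exact_mod_cast h3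
  lift c to ℕ using hc0
  refine ⟨c * 2 ^ (l' - s) + t, l', fun x y hy => ?_⟩
  have hx0 := x.2.1
  have hx1 := x.2.2
  have hyg : (y : ℝ) = g + (t + x) / 2 ^ l := by
    rw [hy]
    change _ = (i : ℝ) / 2 ^ r + _
    rw [hpow', div_add_div _ _ (by positivity) (by positivity),
      div_eq_div_iff (by positivity) (by positivity)]
    have : (a : ℝ) = i * 2 ^ (l - r) + t := by exact_mod_cast hait
    rw [this]
    ring
  have hgy : g ≤ y := by
    rw [← Subtype.coe_le_coe, hyg]
    have : 0 ≤ ((t : ℝ) + x) / 2 ^ l := by positivity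
    linarith
  have hyg' : y ≤ g' := by
    rw [← Subtype.coe_le_coe, hyg]
    change (i : ℝ) / 2 ^ r + _ ≤ ((i + 1 : ℕ) : ℝ) / 2 ^ r
    have h1 : (t : ℝ) + 1 ≤ 2 ^ (l - r) := by exact_mod_cast htlt
    have h2 : ((t : ℝ) + x) / 2 ^ l ≤ 1 / 2 ^ r := by
      rw [hpow', div_le_div_iff₀ (by positivity) (by positivity)]
      have : (0 : ℝ) < 2 ^ r := by positivity
      nlinarith
    push_cast
    rw [add_div (i : ℝ)]
    linarith
  change ((f : IncHomeo) y : ℝ) = _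
  have hpk : (2 : ℝ) ^ k / 2 ^ l = 1 / 2 ^ l' := by
    rw [← zpow_natCast, ← zpow_sub₀ two_ne_zero, show k - (l : ℤ) = -(l' : ℤ) by omega, zpow_neg,
      zpow_natCast, one_div]
  have hps : (2 : ℝ) ^ l' = 2 ^ s * 2 ^ (l' - s) := by
    rw [← pow_add]
    congr 1
    omega
  rw [hk y hgy hyg', hyg, hc, add_sub_cancel_left, mul_div_assoc', mul_comm, mul_div_assoc, hpk, hps]
  push_cast
  field_simp
  ring

theorem closure_range_gen : Subgroup.closure (Set.range gen) = ⊤ := by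
  refine (Subgroup.eq_top_iff' _).2 fun f => ?_
  obtain ⟨M, hM⟩ := exists_level f
  obtain ⟨q, hq, hqM⟩ := exists_refinement M
  have h : f * q ∈ Subgroup.closure (Set.range gen) := by
    refine mem_closure_of_cellTo fun j => ?_
    obtain ⟨a, l, hl, h⟩ := hqM j
    obtain ⟨a', l', h'⟩ := hM a l hl (by have := h.add_two_le; omega)
    exact ⟨a', l', fun x => h' x _ (h x)⟩
  simpa using mul_mem h (inv_mem hq)

end ThompsonF

/-! ### Groups generated by a sequence satisfying Thompson's relations -/

section ThompsonRelations

variable {G : Type*} [Group G] {X : ℕ → G}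

/-- The word `X k ^ a₀ * X (k + 1) ^ a₁ * ⋯` of a list `a₀, a₁, …` of exponents. -/
def sortedWord (X : ℕ → G) : ℕ → List ℕ → G
  | _, [] => 1
  | k, a :: as => X k ^ a * sortedWord X (k + 1) as

theorem mul_pow_of_relations (hX : ∀ k n, k < n → X n * X k = X k * X (n + 1)) {k n : ℕ}
    (h : k < n) (a : ℕ) : X n * X k ^ a = X k ^ a * X (n + a) := by
  induction a generalizing n with
  | zero => simp
  | succ a ih =>
    rw [pow_succ', ← mul_assoc, hX k n h, mul_assoc, ih (h.trans (Nat.lt_succ_self n)), mul_assoc,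
      show n + 1 + a = n + (a + 1) by omega]

/-- Moving right past `X k ^ a` turns `X n` into `X (n + a)`. The letter travels, its index growing,
until it meets its own place. -/
theorem exists_mul_sortedWord (hX : ∀ k n, k < n → X n * X k = X k * X (n + 1)) (as : List ℕ)
    {k n : ℕ} (h : k ≤ n) : ∃ bs, X n * sortedWord X k as = sortedWord X k bs := by
  induction as generalizing k n with
  | nil =>
    obtain ⟨d, rfl⟩ := Nat.exists_eq_add_of_le h
    clear h
    induction d generalizing k with
    | zero => exact ⟨[1], by simp [sortedWord]⟩
    | succ d ih =>
      obtain ⟨bs, hbs⟩ := ih (k := k + 1)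
      refine ⟨0 :: bs, ?_⟩
      change X (k + (d + 1)) * 1 = X k ^ 0 * sortedWord X (k + 1) bs
      rw [pow_zero, one_mul, ← hbs, show k + (d + 1) = k + 1 + d by omega]
      rfl
  | cons a as ih =>
    rcases eq_or_lt_of_le h with rfl | h
    · exact ⟨(a + 1) :: as, by rw [sortedWord, sortedWord, pow_succ', mul_assoc]⟩
    · obtain ⟨bs, hbs⟩ := ih (show k + 1 ≤ n + a by omega)
      refine ⟨a :: bs, ?_⟩
      rw [sortedWord, sortedWord, ← mul_assoc, mul_pow_of_relations hX h, mul_assoc, hbs]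

theorem exists_eq_sortedWord (hX : ∀ k n, k < n → X n * X k = X k * X (n + 1)) {p : G}
    (hp : p ∈ Submonoid.closure (Set.range X)) : ∃ as, p = sortedWord X 0 as := by
  induction hp using Submonoid.closure_induction_left with
  | one => exact ⟨[], rfl⟩
  | mul_left x hx y _ ih =>
    obtain ⟨n, rfl⟩ := hx
    obtain ⟨as, rfl⟩ := ih
    exact exists_mul_sortedWord hX as (Nat.zero_le n)

/-- An inverse letter passes a positive one, with one index raised, or cancels it. So the positive
letter either crosses the whole negative word or disappears, which yields the fractions of
`exists_eq_mul_inv`. -/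
theorem exists_inv_mul_eq (hX : ∀ k n, k < n → X n * X k = X k * X (n + 1)) {q : G}
    (hq : q ∈ Submonoid.closure (Set.range X)) (k : ℕ) :
    ∃ q' ∈ Submonoid.closure (Set.range X), q⁻¹ * X k = q'⁻¹ ∨ ∃ m, q⁻¹ * X k = X m * q'⁻¹ := by
  induction hq using Submonoid.closure_induction_right with
  | one => exact ⟨1, one_mem _, Or.inr ⟨k, by simp⟩⟩
  | mul_right x _ y hy ih =>
    obtain ⟨j, rfl⟩ := hy
    have hmem : ∀ i, X i ∈ Submonoid.closure (Set.range X) := fun i =>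
      Submonoid.subset_closure ⟨i, rfl⟩
    obtain ⟨q', hq', h | ⟨m, h⟩⟩ := ih
    · exact ⟨q' * X j, mul_mem hq' (hmem j), Or.inl (by rw [mul_inv_rev, mul_assoc, h, mul_inv_rev])⟩
    · rw [mul_inv_rev, mul_assoc, h, ← mul_assoc]
      rcases lt_trichotomy j m with hj | rfl | hj
      · refine ⟨q' * X j, mul_mem hq' (hmem j), Or.inr ⟨m + 1, ?_⟩⟩
        rw [mul_inv_rev, ← mul_assoc]
        congr 1
        rw [inv_mul_eq_iff_eq_mul, ← mul_assoc, ← hX j m hj, mul_inv_cancel_right]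
      · exact ⟨q', hq', Or.inl (by rw [inv_mul_cancel, one_mul])⟩
      · refine ⟨q' * X (j + 1), mul_mem hq' (hmem _), Or.inr ⟨m, ?_⟩⟩
        rw [mul_inv_rev, ← mul_assoc]
        congr 1
        rw [inv_mul_eq_iff_eq_mul, ← mul_assoc, hX m j hj, mul_inv_cancel_right]

theorem exists_eq_mul_inv (hX : ∀ k n, k < n → X n * X k = X k * X (n + 1)) {g : G}
    (hg : g ∈ Subgroup.closure (Set.range X)) : ∃ p ∈ Submonoid.closure (Set.range X),
      ∃ q ∈ Submonoid.closure (Set.range X), g = p * q⁻¹ := by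
  induction hg using Subgroup.closure_induction_right with
  | one => exact ⟨1, one_mem _, 1, one_mem _, by simp⟩
  | mul_right x _ y hy ih =>
    obtain ⟨k, rfl⟩ := hy
    obtain ⟨p, hp, q, hq, rfl⟩ := ih
    obtain ⟨q', hq', h | ⟨m, h⟩⟩ := exists_inv_mul_eq hX hq k
    · exact ⟨p, hp, q', hq', by rw [mul_assoc, h]⟩
    · exact ⟨p * X m, mul_mem hp (Submonoid.subset_closure ⟨m, rfl⟩), q', hq',
        by rw [mul_assoc, h, mul_assoc]⟩
  | mul_inv_cancel x _ y hy ih =>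
    obtain ⟨k, rfl⟩ := hy
    obtain ⟨p, hp, q, hq, rfl⟩ := ih
    exact ⟨p, hp, X k * q, mul_mem (Submonoid.subset_closure ⟨k, rfl⟩) hq,
      by rw [mul_inv_rev, mul_assoc]⟩

/-- The sequence `a, b, a⁻¹ b a, a⁻² b a², …`. -/
def conjSeq (a b : G) : ℕ → G
  | 0 => a
  | n + 1 => a⁻¹ ^ n * b * a ^ n

theorem conjSeq_add_two (a b : G) (n : ℕ) :
    conjSeq a b (n + 2) = a⁻¹ * conjSeq a b (n + 1) * a := by
  simp only [conjSeq, pow_succ, pow_succ' a⁻¹, mul_assoc]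

/-- Conjugation by `a` raises all positive indices by one, so `k = 1` is the essential case. There
`x_{d+4}` is the conjugate of `x_{d+3}` by `x_{d+2}`; conjugating this by `x₁` gives the relation
for `x_{d+4}` from the two preceding ones. -/
theorem conjSeq_relations {a b : G}
    (h₁ : conjSeq a b 2 * conjSeq a b 1 = conjSeq a b 1 * conjSeq a b 3)
    (h₂ : conjSeq a b 3 * conjSeq a b 1 = conjSeq a b 1 * conjSeq a b 4) (k n : ℕ) (h : k < n) :
    conjSeq a b n * conjSeq a b k = conjSeq a b k * conjSeq a b (n + 1) := by
  have hconj : ∀ k n, conjSeq a b (n + 1) * conjSeq a b (k + 1) =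
      conjSeq a b (k + 1) * conjSeq a b (n + 2) →
      conjSeq a b (n + 2) * conjSeq a b (k + 2) = conjSeq a b (k + 2) * conjSeq a b (n + 3) := by
    intro k n h
    rw [conjSeq_add_two a b n, conjSeq_add_two a b k, conjSeq_add_two a b (n + 1)]
    have : a⁻¹ * (conjSeq a b (n + 1) * conjSeq a b (k + 1)) * a =
        a⁻¹ * (conjSeq a b (k + 1) * conjSeq a b (n + 2)) * a := by rw [h]
    simpa [mul_assoc] using this
  have hsucc : ∀ m, conjSeq a b (m + 2) * conjSeq a b (m + 1) =
      conjSeq a b (m + 1) * conjSeq a b (m + 3) := by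
    intro m
    induction m with
    | zero => exact h₁
    | succ m ih => exact hconj _ _ ih
  have hone : ∀ d, conjSeq a b (d + 2) * conjSeq a b 1 = conjSeq a b 1 * conjSeq a b (d + 3) ∧
      conjSeq a b (d + 3) * conjSeq a b 1 = conjSeq a b 1 * conjSeq a b (d + 4) := by
    intro d
    induction d with
    | zero => exact ⟨h₁, h₂⟩
    | succ d ih =>
      refine ⟨ih.2, ?_⟩
      have e1 := hsucc (d + 1)
      have e2 := hsucc (d + 2)
      refine mul_left_cancel (a := conjSeq a b (d + 2)) ?_
      calc conjSeq a b (d + 2) * (conjSeq a b (d + 4) * conjSeq a b 1)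
          = conjSeq a b (d + 3) * (conjSeq a b (d + 2) * conjSeq a b 1) := by
            rw [← mul_assoc, ← mul_assoc, ← e1]
        _ = conjSeq a b (d + 3) * conjSeq a b 1 * conjSeq a b (d + 3) := by
            rw [ih.1, mul_assoc]
        _ = conjSeq a b 1 * (conjSeq a b (d + 4) * conjSeq a b (d + 3)) := by
            rw [ih.2, mul_assoc]
        _ = conjSeq a b (d + 2) * conjSeq a b 1 * conjSeq a b (d + 5) := by
            rw [e2, ih.1, mul_assoc]
        _ = _ := by rw [mul_assoc]
  cases k with
  | zero =>
    obtain ⟨n, rfl⟩ : ∃ m, n = m + 1 := ⟨n - 1, by omega⟩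
    rw [conjSeq_add_two, ← mul_assoc, ← mul_assoc]
    change _ = a * a⁻¹ * conjSeq a b (n + 1) * a
    rw [mul_inv_cancel, one_mul]
    rfl
  | succ k =>
    induction k generalizing n with
    | zero =>
      obtain ⟨d, rfl⟩ : ∃ d, n = d + 2 := ⟨n - 2, by omega⟩
      exact (hone d).1
    | succ k ih =>
      obtain ⟨d, rfl⟩ : ∃ d, n = d + 2 := ⟨n - 2, by omega⟩
      exact hconj _ _ (ih (d + 1) (by omega))

end ThompsonRelations

/-! ### Uniqueness of sorted words and the finite presentation -/

namespace ThompsonF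

theorem sortedWord_gen_succ (k : ℕ) (as : List ℕ) :
    sortedWord gen (k + 1) as = shift (sortedWord gen k as) := by
  induction as generalizing k with
  | nil => simp [sortedWord]
  | cons a as ih => rw [sortedWord, sortedWord, map_mul, map_pow, ih, gen_succ]

theorem slopeBot_sortedWord_cons (a : ℕ) (as : List ℕ) :
    slopeBot (sortedWord gen 0 (a :: as)) = Multiplicative.ofAdd (-a : ℤ) := by
  rw [sortedWord, map_mul, map_pow, slopeBot_gen_zero, sortedWord_gen_succ, slopeBot_shift, mul_one,
    ← ofAdd_nsmul]
  simp

/-- Sorted words with the same value in Thompson's group have the same value everywhere. -/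
theorem sortedWord_eq_of_gen {G : Type*} [Group G] (X : ℕ → G) {as bs : List ℕ}
    (h : sortedWord gen 0 as = sortedWord gen 0 bs) (k : ℕ) :
    sortedWord X k as = sortedWord X k bs := by
  have hcons : ∀ {a : ℕ} {as : List ℕ}, sortedWord gen 0 (a :: as) = 1 →
      a = 0 ∧ sortedWord gen 0 as = 1 := by
    intro a as h
    have h1 := slopeBot_sortedWord_cons a as
    rw [h, map_one, eq_comm, ofAdd_eq_one] at h1
    have ha : a = 0 := by omega
    subst ha
    rw [sortedWord, pow_zero, one_mul, sortedWord_gen_succ] at h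
    exact ⟨rfl, shift_injective (h.trans (map_one shift).symm)⟩
  -- Lists with equal values may differ by trailing zeros, so words are compared rather than lists.
  have hnil : ∀ {as : List ℕ}, sortedWord gen 0 as = 1 → ∀ k, sortedWord X k as = 1 := by
    intro as
    induction as with
    | nil => exact fun _ _ => rfl
    | cons a as ih =>
      intro h k
      obtain ⟨rfl, h'⟩ := hcons h
      rw [sortedWord, ih h', pow_zero, one_mul]
  induction as generalizing bs k with
  | nil => rw [hnil h.symm]; rfl
  | cons a as ih =>
    cases bs with
    | nil => rw [hnil h]; rfl
    | cons b bs =>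
      -- Only the power of `gen 0` affects the slope at `0`. The remaining tail is a shift, and
      -- `shift` is injective.
      have h1 : slopeBot (sortedWord gen 0 (a :: as)) = slopeBot (sortedWord gen 0 (b :: bs)) := by
        rw [h]
      rw [slopeBot_sortedWord_cons, slopeBot_sortedWord_cons, Multiplicative.ofAdd.apply_eq_iff_eq,
        neg_inj, Nat.cast_inj] at h1
      subst h1
      rw [sortedWord, sortedWord, mul_right_inj, sortedWord_gen_succ, sortedWord_gen_succ] at h
      rw [sortedWord, sortedWord, ih (shift_injective h)]

theorem map_sortedWord {G H : Type*} [Group G] [Group H] (φ : G →* H) (X : ℕ → G) (k : ℕ)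
    (as : List ℕ) : φ (sortedWord X k as) = sortedWord (φ ∘ X) k as := by
  induction as generalizing k with
  | nil => simp [sortedWord]
  | cons a as ih => rw [sortedWord, sortedWord, map_mul, map_pow, ih, Function.comp_apply]

theorem injective_of_relations {G : Type*} [Group G] {X : ℕ → G}
    (hX : ∀ k n, k < n → X n * X k = X k * X (n + 1)) (htop : Subgroup.closure (Set.range X) = ⊤)
    (φ : G →* ThompsonF) (hφ : ∀ n, φ (X n) = gen n) : Function.Injective φ := by
  rw [injective_iff_map_eq_one]
  intro g hg
  obtain ⟨p, hp, q, hq, rfl⟩ := exists_eq_mul_inv hX (htop ▸ Subgroup.mem_top g)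
  obtain ⟨as, rfl⟩ := exists_eq_sortedWord hX hp
  obtain ⟨bs, rfl⟩ := exists_eq_sortedWord hX hq
  rw [map_mul, map_inv, mul_inv_eq_one, map_sortedWord, map_sortedWord,
    show φ ∘ X = gen from funext hφ] at hg
  rw [sortedWord_eq_of_gen X hg, mul_inv_cancel]

theorem conjSeq_gen (n : ℕ) : conjSeq (gen 0) (gen 1) n = gen n := by
  cases n with
  | zero => rfl
  | succ n =>
    induction n with
    | zero => simp [conjSeq]
    | succ n ih =>
      rw [conjSeq_add_two, ih, mul_assoc, gen_mul_gen (Nat.succ_pos n), inv_mul_cancel_left]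

theorem conjSeq_mem_closure {G : Type*} [Group G] (a b : G) (n : ℕ) :
    conjSeq a b n ∈ Subgroup.closure {a, b} := by
  have ha : a ∈ Subgroup.closure {a, b} := Subgroup.subset_closure (by simp)
  have hb : b ∈ Subgroup.closure {a, b} := Subgroup.subset_closure (by simp)
  cases n with
  | zero => exact ha
  | succ n => exact mul_mem (mul_mem (pow_mem (inv_mem ha) n) hb) (pow_mem ha n)

/-- The relators of the finite presentation of Thompson's group with two generators. -/
def relators : Set (FreeGroup (Fin 2)) :=
  let X := conjSeq (FreeGroup.of 0) (FreeGroup.of 1)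
  {(X 2 * X 1) * (X 1 * X 3)⁻¹, (X 3 * X 1) * (X 1 * X 4)⁻¹}

theorem map_conjSeq {G H : Type*} [Group G] [Group H] (φ : G →* H) (a b : G) (n : ℕ) :
    φ (conjSeq a b n) = conjSeq (φ a) (φ b) n := by
  cases n <;> simp [conjSeq]

theorem isFinitelyPresented : Group.IsFinitelyPresented ThompsonF := by
  have : Finite relators := by
    unfold relators
    exact Set.Finite.to_subtype (Set.toFinite _)
  have hrel : ∀ r ∈ relators, FreeGroup.lift (![gen 0, gen 1] : Fin 2 → ThompsonF) r = 1 := by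
    rintro r (rfl | rfl) <;>
    · rw [map_mul, map_inv, mul_inv_eq_one]
      simp only [map_mul, map_conjSeq, FreeGroup.lift_apply_of, Matrix.cons_val_zero,
        Matrix.cons_val_one, conjSeq_gen]
      exact gen_mul_gen (by omega)
  set φ : PresentedGroup relators →* ThompsonF := PresentedGroup.toGroup hrel with hφ
  set a : PresentedGroup relators := PresentedGroup.of 0 with ha
  set b : PresentedGroup relators := PresentedGroup.of 1 with hb
  have hφa : φ a = gen 0 := by rw [hφ, ha, PresentedGroup.toGroup.of]; rfl
  have hφb : φ b = gen 1 := by rw [hφ, hb, PresentedGroup.toGroup.of]; rfl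
  have hφX : ∀ n, φ (conjSeq a b n) = gen n := fun n => by
    rw [map_conjSeq, hφa, hφb, conjSeq_gen]
  have hmk : ∀ n, PresentedGroup.mk relators (conjSeq (FreeGroup.of 0) (FreeGroup.of 1) n) =
      conjSeq a b n := fun n => map_conjSeq _ _ _ n
  have hX := conjSeq_relations (a := a) (b := b)
    (by
      have := PresentedGroup.one_of_mem (rels := relators) (Set.mem_insert _ _)
      rw [map_mul, map_inv, mul_inv_eq_one] at this
      simpa only [map_mul, hmk] using this)
    (by
      have := PresentedGroup.one_of_mem (rels := relators)
        (Set.mem_insert_of_mem _ (Set.mem_singleton _))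
      rw [map_mul, map_inv, mul_inv_eq_one] at this
      simpa only [map_mul, hmk] using this)
  have htop : Subgroup.closure (Set.range (conjSeq a b)) = ⊤ := by
    rw [eq_top_iff, ← PresentedGroup.closure_range_of, Subgroup.closure_le]
    rintro _ ⟨i, rfl⟩
    fin_cases i
    · exact Subgroup.subset_closure ⟨0, rfl⟩
    · exact Subgroup.subset_closure ⟨1, by simp [conjSeq, hb]⟩
  have hinj := injective_of_relations hX htop φ hφX
  have hsurj : Function.Surjective φ := by
    rw [← MonoidHom.range_eq_top, eq_top_iff, ← closure_range_gen, Subgroup.closure_le]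
    rintro _ ⟨n, rfl⟩
    exact ⟨_, hφX n⟩
  exact Group.IsFinitelyPresented.equiv (MulEquiv.ofBijective φ ⟨hinj, hsurj⟩)

instance : Group.FG ThompsonF := by
  rw [Group.fg_iff]
  refine ⟨{gen 0, gen 1}, ?_, Set.toFinite _⟩
  rw [eq_top_iff, ← closure_range_gen, Subgroup.closure_le]
  rintro _ ⟨n, rfl⟩
  have := conjSeq_mem_closure (gen 0) (gen 1) n
  rwa [conjSeq_gen] at this

end ThompsonF

/-! ### Commuting elements of free groups -/

/-- Two commuting elements of a free group are powers of a common element. -/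
theorem IsFreeGroup.exists_mem_zpowers {G : Type*} [Group G] [IsFreeGroup G] {x y : G}
    (h : x * y = y * x) : ∃ z : G, x ∈ Subgroup.zpowers z ∧ y ∈ Subgroup.zpowers z := by
  set S := Subgroup.closure {x, y} with hS
  have hx : x ∈ S := Subgroup.subset_closure (by simp)
  have hy : y ∈ S := Subgroup.subset_closure (by simp)
  have hcomm : ∀ a b : S, a * b = b * a := by
    have : IsMulCommutative S := Subgroup.isMulCommutative_closure (by
      rintro a (rfl | rfl) b (rfl | rfl)
      exacts [rfl, h, h.symm, rfl])
    exact fun a b => mul_comm' a b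
  -- By Nielsen–Schreier this abelian subgroup is free. Two distinct basis elements could be sent to
  -- non-commuting transpositions of three letters, so the basis has at most one element.
  obtain ⟨ι, ⟨e⟩⟩ := IsFreeGroup.nonempty_basis (G := S)
  have hι : Subsingleton ι := by
    classical
    refine ⟨fun i j => ?_⟩
    by_contra hij
    have h1 : FreeGroup.of i * FreeGroup.of j = FreeGroup.of j * FreeGroup.of i := by
      rw [← e.repr_apply_coe, ← e.repr_apply_coe, ← map_mul, hcomm, map_mul]
    have h2 := congrArg (FreeGroup.lift fun m =>
      if m = i then Equiv.swap (0 : Fin 3) 1 else Equiv.swap 1 2) h1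
    simp only [map_mul, FreeGroup.lift_apply_of, if_true, if_neg (Ne.symm hij)] at h2
    exact absurd h2 (by decide)
  rcases isEmpty_or_nonempty ι with hι' | ⟨⟨i⟩⟩
  · have : Subsingleton S := e.repr.toEquiv.subsingleton
    refine ⟨1, ?_, ?_⟩
    · rw [show x = 1 from congrArg Subtype.val (Subsingleton.elim (⟨x, hx⟩ : S) 1)]
      exact one_mem _
    · rw [show y = 1 from congrArg Subtype.val (Subsingleton.elim (⟨y, hy⟩ : S) 1)]
      exact one_mem _
  · have hz : ∀ a : S, (a : G) ∈ Subgroup.zpowers (e i : G) := by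
      intro a
      have h1 : e.repr a ∈ Subgroup.zpowers (FreeGroup.of i) := by
        have : e.repr a ∈ Subgroup.closure (Set.range FreeGroup.of) := by
          rw [FreeGroup.closure_range_of]
          exact Subgroup.mem_top _
        rw [Subgroup.zpowers_eq_closure]
        refine Subgroup.closure_mono ?_ this
        rintro _ ⟨j, rfl⟩
        rw [Subsingleton.elim j i]
        rfl
      obtain ⟨n, hn⟩ := Subgroup.mem_zpowers_iff.1 h1
      refine Subgroup.mem_zpowers_iff.2 ⟨n, ?_⟩
      rw [← Subgroup.coe_zpow]
      refine congrArg Subtype.val (e.repr.injective ?_)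
      rw [map_zpow, FreeGroupBasis.repr_apply_coe, hn]
    exact ⟨e i, hz ⟨x, hx⟩, hz ⟨y, hy⟩⟩

/-! ### Absence of non-abelian free subgroups -/

namespace ThompsonF

theorem apply_inv_eq_self {f : ThompsonF} {x : 𝕀} (h : f x = x) : f⁻¹ x = x := by
  conv_lhs => rw [← h]
  exact inv_apply_self f x

/-- The set of points fixed by the subgroup `K`. -/
def fixedSet (K : Subgroup ThompsonF) : Set 𝕀 := {x | ∀ k ∈ K, k x = x}

theorem isClosed_fixedSet (K : Subgroup ThompsonF) : IsClosed (fixedSet K) := by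
  simp only [fixedSet, Set.ofPred_forall]
  exact isClosed_iInter fun k => isClosed_iInter fun _ => isClosed_eq (continuous k) continuous_id

theorem bot_mem_fixedSet (K : Subgroup ThompsonF) : ⊥ ∈ fixedSet K := fun k _ => apply_bot k

theorem top_mem_fixedSet (K : Subgroup ThompsonF) : ⊤ ∈ fixedSet K := fun k _ => apply_top k

theorem mem_fixedSet_closure {s : Set ThompsonF} {x : 𝕀} :
    x ∈ fixedSet (Subgroup.closure s) ↔ ∀ f ∈ s, f x = x := by
  refine ⟨fun h f hf => h f (Subgroup.subset_closure hf), fun h k hk => ?_⟩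
  induction hk using Subgroup.closure_induction with
  | mem f hf => exact h f hf
  | one => rfl
  | mul f g _ _ hf hg => rw [mul_apply, hg, hf]
  | inv f _ hf => exact apply_inv_eq_self hf

/-- An affine map fixing two points is the identity between them. Thus the fixed set can have
frontier points only finitely often between consecutive breakpoints of `a` and `b`. -/
theorem finite_frontier_fixedSet (a b : ThompsonF) :
    (frontier (fixedSet (Subgroup.closure {a, b}))).Finite := by
  classical
  set Z := fixedSet (Subgroup.closure {a, b}) with hZ
  obtain ⟨A, -, hA⟩ := a.2
  obtain ⟨B, -, hB⟩ := b.2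
  have hsub : frontier Z ⊆ Z := (isClosed_fixedSet _).frontier_subset
  have key : ∀ x ∈ Z, ∀ z ∈ Z, x < z → (∀ c ∈ A ∪ B, ¬ (x < c ∧ c < z)) →
      Set.Icc x z ⊆ Z := by
    intro x hx z hz hxz hfree y hy
    rw [hZ, mem_fixedSet_closure] at hx hz ⊢
    have hxz' : (z : ℝ) - x ≠ 0 := (sub_pos.2 (show (x : ℝ) < z from hxz)).ne'
    have aux : ∀ (f : ThompsonF) (C : Finset 𝕀), (f : IncHomeo).IsPLWith C → C ⊆ A ∪ B →
        f x = x → f z = z → f y = y := by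
      intro f C hC hCs hfx hfz
      obtain ⟨k, hk⟩ := hC x z hxz fun c hc => hfree c (hCs hc)
      have h1 := hk z hxz.le le_rfl
      have h2 := hk y hy.1 hy.2
      rw [hfx] at h1 h2
      rw [hfz] at h1
      have h3 : (2 : ℝ) ^ k = 1 := mul_right_cancel₀ hxz' (by linarith)
      rw [h3] at h2
      exact Subtype.ext (by linarith)
    rintro f (rfl | rfl)
    · exact aux _ A hA Finset.subset_union_left (hx _ (by simp)) (hz _ (by simp))
    · exact aux _ B hB Finset.subset_union_right (hx _ (by simp)) (hz _ (by simp))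
  -- Label a point by the breakpoints to its left. Of three frontier points with one label, the
  -- middle one would be interior.
  refine Set.Finite.of_finite_fibers (fun x => (A ∪ B).filter (· < x)) ?_ ?_
  · refine (Finset.finite_toSet (A ∪ B).powerset).subset ?_
    rintro _ ⟨x, -, rfl⟩
    exact Finset.mem_coe.2 (Finset.mem_powerset.2 (Finset.filter_subset _ _))
  · intro s _
    by_contra hinf
    obtain ⟨t, ht, hcard⟩ := Set.Infinite.exists_subset_card_eq hinf 3
    set e := t.orderEmbOfFin hcard with he
    have hmem : ∀ i, e i ∈ frontier Z ∧ (A ∪ B).filter (· < e i) = s := fun i =>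
      ht (t.orderEmbOfFin_mem hcard i)
    have h01 : e 0 < e 1 := e.strictMono (by decide)
    have h12 : e 1 < e 2 := e.strictMono (by decide)
    have hI := key (e 0) (hsub (hmem 0).1) (e 2) (hsub (hmem 2).1) (h01.trans h12) (by
      rintro c hc ⟨h1, h2⟩
      have h3 : c ∈ (A ∪ B).filter (· < e 2) := Finset.mem_filter.2 ⟨hc, h2⟩
      rw [(hmem 2).2, ← (hmem 0).2] at h3
      exact h1.not_gt (Finset.mem_filter.1 h3).2)
    refine (hmem 1).1.2 (mem_interior_iff_mem_nhds.2 ?_)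
    exact mem_of_superset (Icc_mem_nhds h01 h12) hI

/-- The slope homomorphism at `p` has abelian target, so commutators have slope one there. -/
theorem eventually_eq_of_mem_commutator {K : Subgroup ThompsonF} {w : ThompsonF} (hw : w ∈ ⁅K, K⁆)
    {p : 𝕀} {l : Filter 𝕀} [l.NeBot] (hl : ∀ᶠ x in l, x ≠ p) (hp : p ∈ fixedSet K)
    (ht : ∀ g ∈ K, Tendsto g l l) (he : ∀ g ∈ K, ∃ k, SlopeAlong g p l k) :
    ∀ᶠ x in l, w x = x := by
  obtain ⟨ψ, hψ⟩ := exists_slopeHom K.subtype hl (fun g => hp g g.2) (fun g => ht g g.2)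
    fun g => he g g.2
  have hle : ⁅K, K⁆ ≤ ψ.ker.map K.subtype := by
    refine Subgroup.commutator_le.2 fun g hg h hh => ⟨⁅(⟨g, hg⟩ : K), (⟨h, hh⟩ : K)⁆, ?_, rfl⟩
    change ψ _ = 1
    rw [map_commutatorElement, commutatorElement_eq_one_iff_mul_comm, mul_comm]
  obtain ⟨g, hg, rfl⟩ := hle hw
  have h1 := hψ g
  rw [show ψ g = 1 from hg] at h1
  filter_upwards [h1] with x hx
  rw [hp (K.subtype g) g.2] at hx
  refine Subtype.ext (hx.trans ?_)
  simp

theorem eventually_nhdsGT_eq {K : Subgroup ThompsonF} {w : ThompsonF} (hw : w ∈ ⁅K, K⁆)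
    {p : 𝕀} (hp : p ∈ fixedSet K) (hpt : p < ⊤) : ∀ᶠ x in 𝓝[>] p, w x = x :=
  have : (𝓝[>] p).NeBot := nhdsGT_neBot_of_exists_gt ⟨_, hpt⟩
  eventually_eq_of_mem_commutator hw (eventually_nhdsGT_ne p) hp
    (fun g hg => by
      have := tendsto_nhdsGT g p
      rwa [hp g hg] at this)
    fun g _ => exists_slopeAlong_nhdsGT g hpt

theorem eventually_nhdsLT_eq {K : Subgroup ThompsonF} {w : ThompsonF} (hw : w ∈ ⁅K, K⁆)
    {p : 𝕀} (hp : p ∈ fixedSet K) (hpt : ⊥ < p) : ∀ᶠ x in 𝓝[<] p, w x = x :=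
  have : (𝓝[<] p).NeBot := nhdsLT_neBot_of_exists_lt ⟨_, hpt⟩
  eventually_eq_of_mem_commutator hw (eventually_nhdsLT_ne p) hp
    (fun g hg => by
      have := tendsto_nhdsLT g p
      rwa [hp g hg] at this)
    fun g _ => exists_slopeAlong_nhdsLT g hpt

theorem commutator_le_self {G : Type*} [Group G] (K : Subgroup G) : ⁅K, K⁆ ≤ K :=
  Subgroup.commutator_le.2 fun _ hg _ hh => by
    rw [commutatorElement_def]
    exact mul_mem (mul_mem (mul_mem hg hh) (inv_mem hg)) (inv_mem hh)

/-- The supremum of the orbit of `c` is fixed by `K`. An orbit bounded by `d` would put it in `[c,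
d]`. -/
theorem exists_lt_orbit {K : Subgroup ThompsonF} {c d : 𝕀}
    (hcd : ∀ x ∈ Set.Icc c d, x ∉ fixedSet K) : ∃ h ∈ K, d < h c := by
  by_contra! hle
  set s := sSup {x | ∃ h ∈ K, x = h c} with hs
  have hlub : IsLUB {x | ∃ h ∈ K, x = h c} s := isLUB_sSup _
  refine hcd s ⟨hlub.1 ⟨1, one_mem _, rfl⟩, hlub.2 ?_⟩ fun k hk => ?_
  · rintro _ ⟨h, hh, rfl⟩
    exact hle h hh
  · have himage : (k : IncHomeo) '' {x | ∃ h ∈ K, x = h c} = {x | ∃ h ∈ K, x = h c} := by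
      ext x
      constructor
      · rintro ⟨_, ⟨h, hh, rfl⟩, rfl⟩
        exact ⟨k * h, mul_mem hk hh, rfl⟩
      · rintro ⟨h, hh, rfl⟩
        exact ⟨_, ⟨k⁻¹ * h, mul_mem (inv_mem hk) hh, rfl⟩, by
          rw [mul_apply]
          exact apply_inv_self k _⟩
    have h1 : IsLUB ((k : IncHomeo) '' {x | ∃ h ∈ K, x = h c}) (k s) :=
      ((k : IncHomeo).isLUB_image').2 hlub
    rw [himage] at h1
    exact h1.unique hlub

/-- Iterates of an increasing map move a non-fixed point strictly monotonically. -/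
theorem zpow_eq_zero_of_apply_eq {f : ThompsonF} {x : 𝕀} (hx : f x ≠ x) {n : ℤ}
    (hn : (f ^ n) x = x) : n = 0 := by
  have aux : ∀ (g : ThompsonF) (n : ℕ), (g ^ (n + 1)) x = x → g x = x := by
    intro g n h
    by_contra hne
    have hiter : ∀ n, (g ^ n) x = g^[n] x := by
      intro n
      induction n with
      | zero => rfl
      | succ n ih => rw [pow_succ', mul_apply, ih, Function.iterate_succ_apply']
    rw [hiter] at h
    rcases lt_or_gt_of_ne hne with h' | h'
    · exact ((strictMono g).strictAnti_iterate_of_map_lt h' (Nat.succ_pos n)).ne h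
    · exact ((strictMono g).strictMono_iterate_of_lt_map h' (Nat.succ_pos n)).ne' h
  obtain ⟨m, rfl | rfl⟩ := n.eq_nat_or_neg
  · rcases m with _ | m
    · rfl
    · rw [zpow_natCast] at hn
      exact absurd (aux f m hn) hx
  · rcases m with _ | m
    · rfl
    · rw [zpow_neg, zpow_natCast] at hn
      have := apply_inv_eq_self hn
      rw [inv_inv] at this
      exact absurd (aux f m this) hx

/-- The left endpoints of the components of the complement of `fixedSet K` that are moved by
`w`. -/
def movedComponents (K : Subgroup ThompsonF) (w : ThompsonF) : Set 𝕀 :=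
  {p | ∃ x, w x ≠ x ∧ IsGreatest (fixedSet K ∩ Set.Iic x) p}

theorem movedComponents_subset_frontier {K : Subgroup ThompsonF} {w : ThompsonF} (hw : w ∈ K) :
    movedComponents K w ⊆ frontier (fixedSet K) := by
  rintro p ⟨x, hx, ⟨hp, hpx⟩, hgr⟩
  refine ⟨subset_closure hp, fun hint => ?_⟩
  have hlt : p < x := lt_of_le_of_ne hpx fun h => hx (h ▸ hp w hw)
  have : (𝓝[>] p).NeBot := nhdsGT_neBot_of_exists_gt ⟨_, hlt⟩
  have hint : ∀ᶠ y in 𝓝 p, y ∈ fixedSet K := mem_interior_iff_mem_nhds.1 hint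
  obtain ⟨y, hy, hy'⟩ := ((hint.filter_mono (nhdsWithin_le_nhds (s := Set.Ioi p))).and
    (Ioo_mem_nhdsGT hlt)).exists
  exact hy'.1.not_ge (hgr ⟨hy, hy'.2.le⟩)

theorem exists_isGreatest_fixedSet (K : Subgroup ThompsonF) (x : 𝕀) :
    ∃ p, IsGreatest (fixedSet K ∩ Set.Iic x) p :=
  ((isClosed_fixedSet K).inter isClosed_Iic).isCompact.exists_isGreatest
    ⟨⊥, bot_mem_fixedSet K, Set.mem_Iic.2 bot_le⟩

theorem exists_isLeast_fixedSet (K : Subgroup ThompsonF) (x : 𝕀) :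
    ∃ p, IsLeast (fixedSet K ∩ Set.Ici x) p :=
  ((isClosed_fixedSet K).inter isClosed_Ici).isCompact.exists_isLeast
    ⟨⊤, top_mem_fixedSet K, Set.mem_Ici.2 le_top⟩

theorem isGreatest_apply {K : Subgroup ThompsonF} {k : ThompsonF} (hk : k ∈ K) {x p : 𝕀}
    (h : IsGreatest (fixedSet K ∩ Set.Iic x) p) : IsGreatest (fixedSet K ∩ Set.Iic (k x)) p := by
  refine ⟨⟨h.1.1, ?_⟩, fun z hz => h.2 ⟨hz.1, ?_⟩⟩
  · have := (strictMono k).monotone h.1.2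
    rwa [h.1.1 k hk] at this
  · have := hz.2
    rw [Set.mem_Iic, ← hz.1 k hk, (strictMono k).le_iff_le] at this
    exact this

theorem apply_commute_of_disjoint {w v : ThompsonF} {y : 𝕀} (h : w y = y ∨ v y = y)
    (hw : w (w y) = w y ∨ v (w y) = w y) (hv : w (v y) = v y ∨ v (v y) = v y) :
    w (v y) = v (w y) := by
  rcases h with h | h
  · rw [h]
    rcases hv with hv | hv
    · exact hv
    · have := (strictMono v).injective hv
      rw [this, h]
  · rw [h]
    rcases hw with hw | hw
    · have := (strictMono w).injective hw
      rw [this, h]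
    · exact hw.symm

/-- In the component `(p, q)` containing `x₀`, the support of `w` lies in some `[c, d]`. Conjugating
by an `h ∈ K` that takes `c` past `d` makes the supports disjoint there, so the commutator dies on
`(p, q)`. It also remains trivial wherever `w` was. -/
theorem exists_conj_smaller {K : Subgroup ThompsonF} {w : ThompsonF} (hw : w ∈ ⁅K, K⁆)
    {x₀ : 𝕀} (hx₀ : w x₀ ≠ x₀) :
    ∃ v ∈ ⁅K, K⁆, v x₀ = x₀ ∧ (∃ x₁, v x₁ ≠ x₁ ∧ w x₁ = x₁) ∧
      movedComponents K ⁅w, v⁆ ⊂ movedComponents K w := by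
  have hwK : w ∈ K := commutator_le_self K hw
  obtain ⟨p, hp⟩ := exists_isGreatest_fixedSet K x₀
  obtain ⟨q, hq⟩ := exists_isLeast_fixedSet K x₀
  have hpx : p < x₀ := lt_of_le_of_ne hp.1.2 fun h => hx₀ (h ▸ hp.1.1 w hwK)
  have hxq : x₀ < q := lt_of_le_of_ne hq.1.2 fun h => hx₀ (h ▸ hq.1.1 w hwK)
  have hpq : ∀ x ∈ fixedSet K, p < x → x < q → False := by
    intro x hx h1 h2
    rcases le_total x x₀ with h | h
    · exact h1.not_ge (hp.2 ⟨hx, h⟩)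
    · exact h2.not_ge (hq.2 ⟨hx, h⟩)
  obtain ⟨c, hpc, hc⟩ := (mem_nhdsGT_iff_exists_Ioo_subset' hpx).1
    (eventually_nhdsGT_eq hw hp.1.1 (hpx.trans_le le_top))
  obtain ⟨d, hdq, hd⟩ := (mem_nhdsLT_iff_exists_Ioo_subset' hxq).1
    (eventually_nhdsLT_eq hw hq.1.1 (bot_le.trans_lt hxq))
  have hsupp : ∀ y, p < y → y < q → w y ≠ y → c ≤ y ∧ y ≤ d := by
    intro y h1 h2 hy
    constructor
    · by_contra! h
      exact hy (hc ⟨h1, h⟩)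
    · by_contra! h
      exact hy (hd ⟨h, h2⟩)
  have hmem : ∀ k ∈ K, ∀ y, p < y → y < q → p < k y ∧ k y < q := by
    intro k hk y h1 h2
    have h3 := strictMono k h1
    have h4 := strictMono k h2
    rw [hp.1.1 k hk] at h3
    rw [hq.1.1 k hk] at h4
    exact ⟨h3, h4⟩
  obtain ⟨h, hh, hdc⟩ := exists_lt_orbit (K := K) (c := c) (d := d) fun x hx hxZ =>
    hpq x hxZ (lt_of_lt_of_le hpc hx.1) (lt_of_le_of_lt hx.2 hdq)
  set v := h * w * h⁻¹ with hv
  have hvK' : v ∈ ⁅K, K⁆ := by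
    have h1 : ⁅h, w⁆ ∈ ⁅K, K⁆ := Subgroup.commutator_mem_commutator hh hwK
    have h2 : v = ⁅h, w⁆ * w := by rw [hv, commutatorElement_def]; group
    rw [h2]
    exact mul_mem h1 hw
  have hvK := commutator_le_self K hvK'
  have hvapply : ∀ y, v y = h (w (h⁻¹ y)) := fun y => rfl
  have hvsupp : ∀ y, p < y → y < q → v y ≠ y → d < y := by
    intro y h1 h2 hy
    have h3 : w (h⁻¹ y) ≠ h⁻¹ y := by
      intro h3
      rw [hvapply, h3, apply_inv_self] at hy
      exact hy rfl
    obtain ⟨h4, h5⟩ := hmem _ (inv_mem hh) y h1 h2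
    have h6 := (strictMono h).monotone (hsupp _ h4 h5 h3).1
    rw [apply_inv_self] at h6
    exact hdc.trans_le h6
  have hdisj : ∀ y, p < y → y < q → w y = y ∨ v y = y := by
    intro y h1 h2
    by_contra! hne
    exact (hvsupp y h1 h2 hne.2).not_ge (hsupp y h1 h2 hne.1).2
  have hcomm : ∀ y, p < y → y < q → w (v y) = v (w y) := fun y h1 h2 =>
    apply_commute_of_disjoint (hdisj y h1 h2)
      (hdisj _ (hmem w hwK y h1 h2).1 (hmem w hwK y h1 h2).2)
      (hdisj _ (hmem v hvK y h1 h2).1 (hmem v hvK y h1 h2).2)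
  obtain ⟨h1, h2⟩ := hmem h hh x₀ hpx hxq
  have hvx : v (h x₀) ≠ h x₀ := by
    intro h3
    rw [hvapply, inv_apply_self] at h3
    exact hx₀ ((strictMono h).injective h3)
  refine ⟨v, hvK', (hdisj x₀ hpx hxq).resolve_left hx₀,
    ⟨h x₀, hvx, (hdisj _ h1 h2).resolve_right hvx⟩, ?_, ?_⟩
  · rintro p' ⟨y, hy, hp'⟩
    by_contra hnot
    -- The `K`-orbit of `y` stays in one component. If `w` does not move that component, it fixes
    -- the whole orbit, and `⁅w, v⁆` fixes `y`.
    have hfix : ∀ k ∈ K, w (k y) = k y := fun k hk => by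
      by_contra hne
      exact hnot ⟨k y, hne, isGreatest_apply hk hp'⟩
    refine hy ?_
    have h3 := apply_inv_eq_self (hfix _ (inv_mem hvK))
    rw [commutatorElement_def, mul_apply, mul_apply, mul_apply, h3, apply_inv_self]
    exact hfix 1 (one_mem _)
  · intro hle
    obtain ⟨y, hy, hpy⟩ := hle ⟨x₀, hx₀, hp⟩
    have hcK : ⁅w, v⁆ ∈ K := commutator_le_self K (Subgroup.commutator_mem_commutator hwK hvK)
    have h3 : p < y := lt_of_le_of_ne hpy.1.2 fun h => hy (h ▸ hpy.1.1 _ hcK)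
    have h4 : y < q := by
      by_contra! h
      exact (hpx.trans hxq).not_ge (hpy.2 ⟨hq.1.1, h⟩)
    refine hy ?_
    have hwv : (w * v)⁻¹ ∈ K := inv_mem (mul_mem hwK hvK)
    have hvw : (v * w)⁻¹ ∈ K := inv_mem (mul_mem hvK hwK)
    obtain ⟨h5, h6⟩ := hmem _ hvw y h3 h4
    have h7 := hcomm _ h5 h6
    rw [show ⁅w, v⁆ = w * v * (v * w)⁻¹ by rw [commutatorElement_def]; group]
    change w (v ((v * w)⁻¹ y)) = y
    rw [h7]
    exact apply_inv_self (v * w) y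

theorem noNonabelianFreeSubgroup : NoNonabelianFreeSubgroup ThompsonF := by
  intro H hH a ha b hb
  by_contra hab
  set K := Subgroup.closure {a, b} with hK
  have haK : a ∈ K := Subgroup.subset_closure (by simp)
  have hbK : b ∈ K := Subgroup.subset_closure (by simp)
  have hKH : K ≤ H := by
    rw [hK, Subgroup.closure_le]
    rintro x (rfl | rfl)
    exacts [ha, hb]
  have hne : {w | w ∈ ⁅K, K⁆ ∧ w ≠ 1}.Nonempty := ⟨⁅a, b⁆,
    Subgroup.commutator_mem_commutator haK hbK, by
      rwa [Ne, commutatorElement_eq_one_iff_mul_comm]⟩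
  obtain ⟨w, ⟨hw, hw1⟩, hmin⟩ := WellFounded.has_min
    (measure fun w => (movedComponents K w).ncard).wf _ hne
  have hwK := commutator_le_self K hw
  obtain ⟨x₀, hx₀⟩ : ∃ x, w x ≠ x := by
    by_contra! h
    exact hw1 (ext' h)
  obtain ⟨v, hv, hvx₀, ⟨x₁, hvx₁, hwx₁⟩, hlt⟩ := exists_conj_smaller hw hx₀
  have hvK := commutator_le_self K hv
  have hwv : ⁅w, v⁆ = 1 := by
    by_contra hne
    refine hmin ⁅w, v⁆ ⟨Subgroup.commutator_mem_commutator hwK hvK, hne⟩ ?_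
    exact Set.ncard_lt_ncard hlt
      ((finite_frontier_fixedSet a b).subset (movedComponents_subset_frontier hwK))
  rw [commutatorElement_eq_one_iff_mul_comm] at hwv
  obtain ⟨z, hz, hz'⟩ := IsFreeGroup.exists_mem_zpowers (G := H) (x := ⟨w, hKH hwK⟩)
    (y := ⟨v, hKH hvK⟩) (Subtype.ext hwv)
  obtain ⟨i, hi⟩ := Subgroup.mem_zpowers_iff.1 hz
  obtain ⟨j, hj⟩ := Subgroup.mem_zpowers_iff.1 hz'
  have hi : (z : ThompsonF) ^ i = w := congrArg Subtype.val hi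
  have hj : (z : ThompsonF) ^ j = v := congrArg Subtype.val hj
  have heq : w ^ j = v ^ i := by rw [← hi, ← hj, ← zpow_mul, ← zpow_mul, mul_comm]
  have hfix : ∀ {f : ThompsonF} {x : 𝕀} (n : ℤ), f x = x → (f ^ n) x = x := by
    intro f x n hf
    have hle : Subgroup.zpowers f ≤ Subgroup.closure {f} := by rw [Subgroup.zpowers_eq_closure]
    have : x ∈ fixedSet (Subgroup.closure {f}) := mem_fixedSet_closure.2 (by
      rintro g rfl
      exact hf)
    exact this _ (hle (Subgroup.mem_zpowers_iff.2 ⟨n, rfl⟩))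
  -- At `x₁` the power `w ^ j = v ^ i` acts trivially although `v` does not, so `i = 0` and `w = 1`.
  have hi0 : i = 0 := zpow_eq_zero_of_apply_eq hvx₁ (heq ▸ hfix j hwx₁)
  rw [hi0, zpow_zero] at hi
  exact hw1 hi.symm

end ThompsonF

/-! ### Finite generation and realisability -/

theorem Subgroup.fg_map_iff_of_injective {G H : Type*} [Group G] [Group H] {φ : G →* H}
    (hφ : Function.Injective φ) (K : Subgroup G) : (K.map φ).FG ↔ K.FG := by
  rw [← Group.fg_iff_subgroup_fg, ← Group.fg_iff_subgroup_fg]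
  exact ⟨fun _ => Group.fg_of_surjective (K.equivMapOfInjective φ hφ).symm.surjective
      (f := (K.equivMapOfInjective φ hφ).symm.toMonoidHom),
    fun _ => Group.fg_of_surjective (K.equivMapOfInjective φ hφ).surjective
      (f := (K.equivMapOfInjective φ hφ).toMonoidHom)⟩

theorem Subgroup.FG.map_hom {G H : Type*} [Group G] [Group H] {K : Subgroup G} (hK : K.FG)
    (φ : G →* H) : (K.map φ).FG := by
  classical
  obtain ⟨S, rfl⟩ := hK
  exact ⟨S.image φ, by rw [Finset.coe_image, MonoidHom.map_closure]⟩

theorem Subgroup.fg_pi_iff {ι : Type*} [Finite ι] {G : ι → Type*} [∀ i, Group (G i)]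
    (P : ∀ i, Subgroup (G i)) : (Subgroup.pi Set.univ P).FG ↔ ∀ i, (P i).FG := by
  classical
  refine ⟨fun h i => ?_, fun h => Subgroup.FG.pi h⟩
  convert h.map_hom (Pi.evalMonoidHom G i)
  ext x
  refine ⟨fun hx => ⟨Pi.mulSingle i x, fun j _ => ?_, by simp⟩, ?_⟩
  · by_cases hj : j = i
    · subst hj
      simpa using hx
    · simp [Pi.mulSingle_eq_of_ne hj]
  · rintro ⟨y, hy, rfl⟩
    exact hy i trivial

theorem Configuration.Realisable.of_injective {n : ℕ} {c : Configuration n} {G H : Type*} [Group G]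
    [Group H] {φ : G →* H} (hφ : Function.Injective φ) (h : c.Realisable G) : c.Realisable H := by
  obtain ⟨K, hK⟩ := h
  refine ⟨fun i => (K i).map φ, fun I => ?_⟩
  rw [← hK I, ← Subgroup.fg_map_iff_of_injective hφ]
  have : Nonempty I.1 := I.2.to_subtype
  rw [iInf_subtype', iInf_subtype', Subgroup.map_iInf φ hφ]

/-- Configurations with values in a product of groups are realisable if their indicator
configurations are realisable in the factors. -/
theorem Configuration.realisable_of_forall {n : ℕ} (c : Configuration n) {M : Type*} [Group M]
    (h : ∀ I : Finset (Fin n), ∃ H : Fin n → Subgroup M, ∀ J : Finset (Fin n), J.Nonempty →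
      ((⨅ i ∈ J, H i).FG ↔ J ≠ I)) :
    c.Realisable ({I : Finset (Fin n) // I.Nonempty} → M) := by
  classical
  choose H hH using h
  -- The factor indexed by `I` is used only when `c I = 1`; it then spoils finite generation exactly
  -- for the index set `I`.
  refine ⟨fun i => Subgroup.pi Set.univ fun I => if c I = 0 then ⊥ else H I.1 i, fun J => ?_⟩
  have hJ : (⨅ i ∈ J.1, Subgroup.pi Set.univ fun I : {I : Finset (Fin n) // I.Nonempty} =>
      if c I = 0 then ⊥ else H I.1 i) = Subgroup.pi Set.univ fun I =>
      if c I = 0 then ⊥ else ⨅ i ∈ J.1, H I.1 i := by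
    ext x
    simp only [Subgroup.mem_iInf, Subgroup.mem_pi, Set.mem_univ, true_imp_iff]
    constructor
    · intro hx I
      split_ifs with hI
      · obtain ⟨i, hi⟩ := J.2
        have := hx i hi I
        rwa [if_pos hI] at this
      · simp only [Subgroup.mem_iInf]
        intro i hi
        have := hx i hi I
        rwa [if_neg hI] at this
    · intro hx i hi I
      have := hx I
      split_ifs with hI
      · rwa [if_pos hI] at this
      · rw [if_neg hI] at this
        simp only [Subgroup.mem_iInf] at this
        exact this i hi
  rw [hJ, Subgroup.fg_pi_iff]
  constructor
  · intro h
    by_contra hc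
    have := h J
    rw [if_neg hc, hH J.1 J.1 J.2] at this
    exact this rfl
  · intro hc I
    split_ifs with hI
    · exact Subgroup.FG.bot
    · rw [hH I.1 J.1 J.2]
      intro h
      exact hI (Subtype.ext h ▸ hc)

namespace ThompsonF

/-! ### Embeddings into Thompson's group -/

/-- The group `G` embeds into Thompson's group. -/
def Embeds (G : Type*) [Group G] : Prop := ∃ φ : G →* ThompsonF, Function.Injective φ

theorem Embeds.of_injective {G H : Type*} [Group G] [Group H] (hH : Embeds H) {φ : G →* H}
    (hφ : Function.Injective φ) : Embeds G := by
  obtain ⟨ψ, hψ⟩ := hH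
  exact ⟨ψ.comp φ, hψ.comp hφ⟩

theorem Embeds.prod {G H : Type*} [Group G] [Group H] (hG : Embeds G) (hH : Embeds H) :
    Embeds (G × H) := by
  obtain ⟨φ, hφ⟩ := hG
  obtain ⟨ψ, hψ⟩ := hH
  exact ⟨pair.comp (φ.prodMap ψ), pair_injective.comp (hφ.prodMap hψ)⟩

theorem Embeds.pi_fin {G : Type*} [Group G] (hG : Embeds G) (n : ℕ) : Embeds (Fin n → G) := by
  induction n with
  | zero => exact ⟨1, Function.injective_of_subsingleton _⟩
  | succ n ih =>
    refine (hG.prod ih).of_injective (φ := (Pi.evalMonoidHom _ 0).prod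
      { toFun := fun f i => f i.succ, map_one' := rfl, map_mul' := fun _ _ => rfl }) ?_
    intro f g h
    rw [Prod.ext_iff] at h
    funext i
    refine Fin.cases h.1 (fun i => ?_) i
    exact congrFun h.2 i

theorem Embeds.pi {G : Type*} [Group G] (hG : Embeds G) (ι : Type*) [Finite ι] :
    Embeds (ι → G) := by
  obtain ⟨n, ⟨e⟩⟩ := Finite.exists_equiv_fin ι
  refine (hG.pi_fin n).of_injective (φ :=
    { toFun := fun f i => f (e.symm i), map_one' := rfl, map_mul' := fun _ _ => rfl }) ?_
  intro f g h
  funext i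
  simpa using congrFun h (e i)

theorem embeds_self : Embeds ThompsonF := ⟨MonoidHom.id _, Function.injective_id⟩

theorem embeds_int : Embeds (Multiplicative ℤ) := by
  refine ⟨zpowersHom _ (gen 0), ?_⟩
  rw [injective_iff_map_eq_one]
  intro n hn
  have h1 := congrArg (fun g => (slopeBot g).toAdd) hn
  simp only [zpowersHom_apply, map_zpow, slopeBot_gen_zero, map_one, toAdd_zpow, toAdd_ofAdd,
    toAdd_one] at h1
  have : n.toAdd = 0 := by simpa using h1
  exact this

/-! ### The kernel of the slope at `0` -/

theorem gen_zero_apply_lt {x : 𝕀} (h0 : ⊥ < x) (h1 : x < ⊤) : gen 0 x < x := by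
  have h0 : (0 : ℝ) < x := h0
  have h1 : (x : ℝ) < 1 := h1
  rw [← Subtype.coe_lt_coe]
  change (IncHomeo.x₀ x : ℝ) < x
  rw [IncHomeo.coe_x₀]
  exact max_lt (max_lt (by linarith) (by linarith)) (by linarith)

/-- Finitely many elements of slope one at `0` fix a common interval `(0, u)` pointwise, hence so
does the group they generate. Conjugates of `gen 1` lie in the kernel and move points arbitrarily
close to `0`. -/
theorem not_fg_ker_slopeBot : ¬ slopeBot.ker.FG := by
  rintro ⟨S, hS⟩
  have hS' : ∀ᶠ x in 𝓝[>] (⊥ : 𝕀), ∀ s ∈ S, s x = x := by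
    refine (Finset.eventually_all S).2 fun s hs => ?_
    have hker : slopeBot s = 1 := by
      have : s ∈ slopeBot.ker := hS ▸ Subgroup.subset_closure hs
      exact this
    have h1 := slopeAlong_slopeBot s
    rw [hker] at h1
    filter_upwards [h1] with x hx
    rw [apply_bot] at hx
    refine Subtype.ext (hx.trans ?_)
    simp
  have hfix : ∀ᶠ x in 𝓝[>] (⊥ : 𝕀), x ∈ fixedSet slopeBot.ker := by
    filter_upwards [hS'] with x hx
    rw [← hS]
    exact mem_fixedSet_closure.2 hx
  obtain ⟨u, hu, hu'⟩ := (mem_nhdsGT_iff_exists_Ioo_subset' bot_lt_top).1 hfix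
  obtain ⟨c, hc⟩ := Filter.nonempty_of_mem (Ioo_mem_nhdsGT (Set.mem_Ioi.1 hu))
  set x := lo ⊤ with hx
  have hx0 : ⊥ < x := by
    rw [hx, ← lo_bot]
    exact lo_strictMono bot_lt_top
  have hx1 : x < ⊤ := by
    rw [hx, lo_top, ← hi_top]
    exact hi_strictMono bot_lt_top
  set y := hi x with hy
  have hy1 : y < ⊤ := by
    rw [hy, ← hi_top]
    exact hi_strictMono hx1
  have hy0 : ⊥ < y := bot_le.trans_lt (hi_strictMono hx0)
  have hyne : gen 1 y ≠ y := by
    rw [hy, gen_succ, shift_hi]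
    exact fun h => (gen_zero_apply_lt hx0 hx1).ne (hi_injective h)
  -- `F` itself has no fixed point in `(0, 1)`, so some `h` takes `c` past `y`. Its inverse then
  -- brings the moved point `y` below `c`.
  obtain ⟨h, -, hh⟩ := exists_lt_orbit (K := ⊤) (c := c) (d := y) fun z hz hz' =>
    (gen_zero_apply_lt (hc.1.trans_le hz.1) (lt_of_le_of_lt hz.2 hy1)).ne
      (hz' (gen 0) (Subgroup.mem_top _))
  set z := h⁻¹ y with hz
  have hz0 : ⊥ < z := by
    have := strictMono h⁻¹ hy0
    rwa [apply_bot] at this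
  have hzc : z < c := by
    have := strictMono h⁻¹ hh
    rwa [inv_apply_self] at this
  have hw : h⁻¹ * gen 1 * h ∈ slopeBot.ker := by
    change slopeBot _ = 1
    rw [map_mul, map_mul, map_inv, gen_succ, slopeBot_shift, mul_one, inv_mul_cancel]
  have hwz := hu' ⟨hz0, hzc.trans hc.2⟩ _ hw
  rw [mul_apply, mul_apply, hz, apply_inv_self] at hwz
  exact hyne ((strictMono h⁻¹).injective hwz)

/-! ### Intersection saturation -/

/-- The pairs `(g, v)` such that `v` is supported in `T` and its coordinates add up to the
logarithm of the slope of `g` at `0`. -/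
def slopeFiber {n : ℕ} (T : Finset (Fin n)) : Subgroup (ThompsonF × (Fin n → Multiplicative ℤ)) where
  carrier := {p | ∏ j, p.2 j = slopeBot p.1 ∧ ∀ j ∉ T, p.2 j = 1}
  one_mem' := by simp
  mul_mem' := by
    rintro p q ⟨hp, hp'⟩ ⟨hq, hq'⟩
    refine ⟨?_, fun j hj => ?_⟩
    · simp only [Prod.snd_mul, Pi.mul_apply, Finset.prod_mul_distrib, hp, hq, Prod.fst_mul, map_mul]
    · rw [Prod.snd_mul, Pi.mul_apply, hp' j hj, hq' j hj, one_mul]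
  inv_mem' := by
    rintro p ⟨hp, hp'⟩
    refine ⟨?_, fun j hj => ?_⟩
    · simp only [Prod.snd_inv, Pi.inv_apply, Finset.prod_inv_distrib, hp, Prod.fst_inv, map_inv]
    · rw [Prod.snd_inv, Pi.inv_apply, hp' j hj, inv_one]

theorem mem_slopeFiber {n : ℕ} {T : Finset (Fin n)} {p : ThompsonF × (Fin n → Multiplicative ℤ)} :
    p ∈ slopeFiber T ↔ ∏ j, p.2 j = slopeBot p.1 ∧ ∀ j ∉ T, p.2 j = 1 := Iff.rfl

/-- The group is a retract of the finitely generated `F × ℤⁿ`: truncate `v` to `T`, then correct the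
coordinate `t ∈ T` so that the sum is right. -/
theorem fg_slopeFiber {n : ℕ} {T : Finset (Fin n)} (hT : T.Nonempty) : (slopeFiber T).FG := by
  classical
  obtain ⟨t, ht⟩ := hT
  let ρ : (Fin n → Multiplicative ℤ) →* (Fin n → Multiplicative ℤ) :=
    { toFun := fun u j => if j ∈ T then u j else 1
      map_one' := by ext; simp
      map_mul' := fun u v => by
        funext j
        by_cases hj : j ∈ T <;> simp [hj] }
  let π : (Fin n → Multiplicative ℤ) →* Multiplicative ℤ :=
    { toFun := fun u => ∏ j, u j
      map_one' := by simp
      map_mul' := fun u v => Finset.prod_mul_distrib }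
  let ε : ThompsonF × (Fin n → Multiplicative ℤ) →* ThompsonF × (Fin n → Multiplicative ℤ) :=
    (MonoidHom.fst _ _).prod ((ρ.comp (MonoidHom.snd _ _)) *
      (MonoidHom.mulSingle (fun _ : Fin n => Multiplicative ℤ) t).comp
        (slopeBot.comp (MonoidHom.fst _ _) / (π.comp ρ).comp (MonoidHom.snd _ _)))
  have hρ : ∀ u, ∀ j, ρ u j = if j ∈ T then u j else 1 := fun _ _ => rfl
  have hε : ∀ p, ε p = (p.1, ρ p.2 * Pi.mulSingle t (slopeBot p.1 / ∏ j, ρ p.2 j)) := fun _ => rfl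
  have hrange : ε.range = slopeFiber T := by
    ext p
    rw [MonoidHom.mem_range]
    constructor
    · rintro ⟨q, rfl⟩
      rw [hε, mem_slopeFiber]
      refine ⟨?_, fun j hj => ?_⟩
      · simp only [Pi.mul_apply, Finset.prod_mul_distrib, Finset.prod_pi_mulSingle',
          Finset.mem_univ, if_true]
        rw [mul_div_cancel]
      · have hjt : j ≠ t := fun h => hj (h ▸ ht)
        change ρ q.2 j * Pi.mulSingle (M := fun _ => Multiplicative ℤ) t _ j = 1
        rw [hρ, if_neg hj, Pi.mulSingle_eq_of_ne hjt, one_mul]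
    · rintro ⟨h1, h2⟩
      refine ⟨p, ?_⟩
      have h3 : ρ p.2 = p.2 := by
        funext j
        rw [hρ]
        split_ifs with hj
        · rfl
        · exact (h2 j hj).symm
      rw [hε, h3, h1, div_self', Pi.mulSingle_one, mul_one]
  rw [← hrange, ← Group.fg_iff_subgroup_fg]
  infer_instance

theorem not_fg_slopeFiber_empty {n : ℕ} : ¬ (slopeFiber (∅ : Finset (Fin n))).FG := by
  intro h
  refine not_fg_ker_slopeBot ?_
  convert h.map_hom (MonoidHom.fst _ _)
  ext g
  constructor
  · intro hg
    exact ⟨(g, 1), ⟨by simpa using (MonoidHom.mem_ker.1 hg).symm, fun _ _ => rfl⟩, rfl⟩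
  · rintro ⟨p, ⟨hp, hp'⟩, rfl⟩
    rw [MonoidHom.mem_ker]
    change slopeBot p.1 = 1
    rw [← hp]
    exact Finset.prod_eq_one fun j _ => hp' j (Finset.notMem_empty j)

/-- Use `slopeFiber (I \ {i})` for `i ∈ I` and the trivial group otherwise. Intersecting over `J ⊆
I` leaves `slopeFiber (I \ J)`, whose support set is empty only for `J = I`. -/
theorem exists_indicator {n : ℕ} (I : Finset (Fin n)) :
    ∃ H : Fin n → Subgroup (ThompsonF × (Fin n → Multiplicative ℤ)),
      ∀ J : Finset (Fin n), J.Nonempty → ((⨅ i ∈ J, H i).FG ↔ J ≠ I) := by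
  classical
  refine ⟨fun i => if i ∈ I then slopeFiber (I.erase i) else ⊥, fun J hJ => ?_⟩
  by_cases hJI : J ⊆ I
  · have h1 : (⨅ i ∈ J, if i ∈ I then slopeFiber (I.erase i) else ⊥) = slopeFiber (I \ J) := by
      ext p
      simp only [Subgroup.mem_iInf]
      constructor
      · intro h
        obtain ⟨i, hi⟩ := hJ
        have h2 := h i hi
        rw [if_pos (hJI hi)] at h2
        refine ⟨h2.1, fun j hj => ?_⟩
        by_cases hjJ : j ∈ J
        · have h3 := h j hjJ
          rw [if_pos (hJI hjJ)] at h3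
          exact h3.2 j (Finset.notMem_erase j I)
        · refine h2.2 j fun hj' => hj ?_
          exact Finset.mem_sdiff.2 ⟨Finset.mem_of_mem_erase hj', hjJ⟩
      · intro h i hi
        rw [if_pos (hJI hi)]
        refine ⟨h.1, fun j hj => h.2 j fun hj' => hj ?_⟩
        obtain ⟨h2, h3⟩ := Finset.mem_sdiff.1 hj'
        exact Finset.mem_erase.2 ⟨fun h => h3 (h ▸ hi), h2⟩
    rw [h1]
    constructor
    · rintro h rfl
      rw [Finset.sdiff_self] at h
      exact not_fg_slopeFiber_empty h
    · intro hne
      refine fg_slopeFiber (Finset.sdiff_nonempty.2 fun h => hne (hJI.antisymm h))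
  · obtain ⟨i, hi, hiI⟩ := Finset.not_subset.1 hJI
    have h1 : (⨅ i ∈ J, if i ∈ I then slopeFiber (I.erase i) else ⊥) = ⊥ := by
      refine eq_bot_iff.2 ((iInf₂_le i hi).trans ?_)
      rw [if_neg hiI]
    rw [h1]
    exact ⟨fun _ h => hJI h.subset, fun _ => Subgroup.FG.bot⟩

theorem intersectionSaturated : IntersectionSaturated ThompsonF := by
  intro n _ c
  obtain ⟨φ, hφ⟩ := (embeds_self.prod (embeds_int.pi (Fin n))).pi
    {I : Finset (Fin n) // I.Nonempty}
  exact (c.realisable_of_forall exists_indicator).of_injective hφ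

end ThompsonF

/-- Thompson's group `F` is finitely presented, intersection-saturated, and has no non-abelian free
subgroup. -/
theorem corollaryB :
    Group.IsFinitelyPresented ThompsonF ∧ IntersectionSaturated ThompsonF ∧
      NoNonabelianFreeSubgroup ThompsonF :=
  ⟨ThompsonF.isFinitelyPresented, ThompsonF.intersectionSaturated,
    ThompsonF.noNonabelianFreeSubgroup⟩
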